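/- Let $n,n_1$ be dimensions, $T>0$, and let $A,G,\Gamma,\Gamma_f\in\mathbb R^{n\times n}$, $B,B_0,B_1\in\mathbb R^{n\times n_1}$ be constant matrices and $Q,Q_f\in\mathbb R^{n\times n}$, $R\in\mathbb R^{n_1\times n_1}$ symmetric, possibly indefinite, matrices. Consider the $N$-player linear-quadratic Nash game in which player $i$, $1\le i\le N$, has the dynamics $$dX_i=(AX_i+Bu_i+GX^{(N)})\,dt+B_1u_i\,dW_i+B_0u^{(N)}\,dW_0,\qquad X^{(N)}=\tfrac1N\sum_{k=1}^N X_k,\quad u^{(N)}=\tfrac1N\sum_{k=1}^N u_k,$$ with independent standard Brownian motions $W_0,W_1,\dots,W_N$, and the cost (where $[x]_M^2=x^TMx$) $$J_i=\mathbb E\Big[\int_0^T\big([X_i-\Gamma X^{(N)}]_Q^2+[u_i]_R^2\big)dt+[X_i(T)-\Gamma_fX^{(N)}(T)]_{Q_f}^2\Big].$$ For each $N$ put $\mathbf A=\mathrm{diag}[A,\dots,A]+\mathbf 1_{N\times N}\otimes\frac GN$, $\mathbf B_0=\mathbf 1_{N\times1}\otimes\frac{B_0}N$, $\widehat{\mathbf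 B}_k=e_k^N\otimes B$, $\mathbf B_k=e_k^N\otimes B_1$, $\mathbf Q_i=\mathbf K_i^TQ\mathbf K_i$ and $\mathbf Q_{if}=\mathbf K_{if}^TQ_f\mathbf K_{if}$, where $\mathbf K_i=(e_i^N)^T\otimes I_n-\frac1N\mathbf 1_{1\times N}\otimes\Gamma$ and $\mathbf K_{if}=(e_i^N)^T\otimes I_n-\frac1N\mathbf 1_{1\times N}\otimes\Gamma_f$. For symmetric $\mathbf P_1,\dots,\mathbf P_N\in\mathbb R^{Nn\times Nn}$ write $$\mathbf R_k=R+\mathbf B_k^T\mathbf P_k\mathbf B_k,\quad \mathbf S_k=\mathbf B_0^T\mathbf P_k\mathbf B_0,\quad \mathbf I_0=I+\sum_{k=1}^N\mathbf R_k^{-1}\mathbf S_k,$$ $$\mathbf M_0=-\mathbf I_0^{-1}\sum_{k=1}^N\mathbf R_k^{-1}\widehat{\mathbf B}_k^T\mathbf P_k,\quad \mathbf U_k=\mathbf S_k\mathbf M_0+\widehat{\mathbf B}_k^T\mathbf P_k .$$ A solution on $[0,T]$ of the large Riccati system is a tuple of differentiable symmetric-matrix-valued functions $(\mathbf P_1,\dots,\mathbf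 P_N)$ on $[0,T]$ such that, for all $t\in[0,T]$ and $1\le i\le N$, $$\begin{aligned}-\dot{\mathbf P}_i={}&\mathbf P_i\mathbf A+\mathbf A^T\mathbf P_i+\mathbf Q_i-\mathbf P_i\widehat{\mathbf B}_i\mathbf R_i^{-1}\widehat{\mathbf B}_i^T\mathbf P_i+\mathbf M_0^T\mathbf S_i\mathbf R_i^{-1}\mathbf S_i\mathbf M_0-\mathbf P_i\sum_{k\ne i}\widehat{\mathbf B}_k\mathbf R_k^{-1}\mathbf U_k\\&-\sum_{k\ne i}\mathbf U_k^T\mathbf R_k^{-1}\widehat{\mathbf B}_k^T\mathbf P_i+\sum_{k\ne i}\mathbf U_k^T\mathbf R_k^{-1}\mathbf B_k^T\mathbf P_i\mathbf B_k\mathbf R_k^{-1}\mathbf U_k+\mathbf M_0^T\mathbf S_i\mathbf M_0,\end{aligned}$$ $\mathbf P_i(T)=\mathbf Q_{if}$, and for all $t\in[0,T]$ and all $i$: $\mathbf R_i>0$, $\mathbf R_i+\mathbf S_i>0$, and $\mathbf I_0$ is invertible. For $N\ge3$, let $\Pi_1^N,\Pi_2^N,\Pi_3^N,\Pi_4^N$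 be the $n\times n$ blocks of $\mathbf P_1$ in the positions $(1,1)$, $(1,2)$, $(2,2)$, $(2,3)$, and let $|\cdot|$ be the Euclidean (Frobenius) norm. The game is called asymptotically solvable if there exist $N_0\ge 3$ and $c_0>0$ such that for all $N\ge N_0$ the large Riccati system has a solution $(\mathbf P_1,\dots,\mathbf P_N)$ on $[0,T]$, and $$\sup_{N\ge N_0}\sup_{0\le t\le T}\big(|\Pi_1^N|+N|\Pi_2^N|+N^2|\Pi_3^N|+N^2|\Pi_4^N|\big)<\infty,$$ and for all $N\ge N_0$ and $t\in[0,T]$: $\mathbf R_i\ge c_0I$ for all $1\le i\le N$, and $\mathbf I_0$ is invertible. **Theorem.** The game is asymptotically solvable if and only if there exist differentiable functions $\Lambda_1,\Lambda_2:[0,T]\to\mathbb R^{n\times n}$, with $\Lambda_1(t)$ symmetric, such that, with $H=(R+B_1^T\Lambda_1B_1)^{-1}$, $$\begin{aligned}&\dot\Lambda_1=\Lambda_1BHB^T\Lambda_1-\Lambda_1A-A^T\Lambda_1-Q,\qquad \Lambda_1(T)=Q_f,\qquad R+B_1^T\Lambda_1(t)B_1>0\quad\forall t\in[0,T],\\ &\dot\Lambda_2=-\Lambda_1G-\Lambda_2(A+G)-A^T\Lambda_2+\Lambda_1BHB^T\Lambda_2+\Lambda_2BHB^T\Lambda_1+\Lambda_2BHB^T\Lambda_2+Q\Gamma,\qquad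 \Lambda_2(T)=-Q_f\Gamma_f\end{aligned}$$ on $[0,T]$. -/

import Mathlib

open Matrix Set

open scoped Matrix.Norms.Frobenius in
/-- The Euclidean norm `|F|` of a real matrix, i.e. the square root of the sum of the squares of
its entries. -/
noncomputable def euclNorm {a b : Type*} [Fintype a] [Fintype b] (F : Matrix a b ℝ) : ℝ := ‖F‖

/-- The constant coefficients of the LQ Nash game with states in `ℝⁿ`, controls in `ℝᵐ` and
horizon `[0, T]`: player `i` has the dynamics
`dXᵢ = (A Xᵢ + B uᵢ + G X⁽ᴺ⁾) dt + B₁ uᵢ dWᵢ + B₀ u⁽ᴺ⁾ dW₀`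
and the cost
`E ∫₀ᵀ ([Xᵢ - Γ X⁽ᴺ⁾]²_Q + [uᵢ]²_R) dt + E [Xᵢ(T) - Γf X⁽ᴺ⁾(T)]²_{Qf}`. -/
structure LQGame (n m : ℕ) where
  A : Matrix (Fin n) (Fin n) ℝ
  G : Matrix (Fin n) (Fin n) ℝ
  B : Matrix (Fin n) (Fin m) ℝ
  B₀ : Matrix (Fin n) (Fin m) ℝ
  B₁ : Matrix (Fin n) (Fin m) ℝ
  Γ : Matrix (Fin n) (Fin n) ℝ
  Γf : Matrix (Fin n) (Fin n) ℝ
  Q : Matrix (Fin n) (Fin n) ℝ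
  Qf : Matrix (Fin n) (Fin n) ℝ
  R : Matrix (Fin m) (Fin m) ℝ
  T : ℝ

namespace LQGame

variable {n m : ℕ} (g : LQGame n m)

section BigSystem

/- An `Nn × Nn` matrix is indexed by `Fin N × Fin n`; the pair `(j, a)` is the `a`-th coordinate
of the state of player `j`. -/
variable (N : ℕ)

/-- `𝐀 = diag[A, …, A] + 𝟏_{N×N} ⊗ (G/N)`. -/
noncomputable def bigA : Matrix (Fin N × Fin n) (Fin N × Fin n) ℝ :=
  Matrix.of fun p q => (if p.1 = q.1 then g.A p.2 q.2 else 0) + g.G p.2 q.2 / N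

/-- `𝐁₀ = 𝟏_{N×1} ⊗ (B₀/N)`. -/
noncomputable def bigB₀ : Matrix (Fin N × Fin n) (Fin m) ℝ :=
  Matrix.of fun p b => g.B₀ p.2 b / N

/-- `𝐁̂ₖ = eₖ ⊗ B`. -/
def bigBhat (k : Fin N) : Matrix (Fin N × Fin n) (Fin m) ℝ :=
  Matrix.of fun p b => if p.1 = k then g.B p.2 b else 0

/-- `𝐁ₖ = eₖ ⊗ B₁`. -/
def bigB (k : Fin N) : Matrix (Fin N × Fin n) (Fin m) ℝ :=
  Matrix.of fun p b => if p.1 = k then g.B₁ p.2 b else 0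

/-- `[0, …, 0, I, 0, …, 0] - (1/N) [Θ, …, Θ]`, with `I` in the `i`-th block. -/
noncomputable def bigK (Θ : Matrix (Fin n) (Fin n) ℝ) (i : Fin N) :
    Matrix (Fin n) (Fin N × Fin n) ℝ :=
  Matrix.of fun a q => (if q.1 = i then (1 : Matrix (Fin n) (Fin n) ℝ) a q.2 else 0) - Θ a q.2 / N

/-- `𝐐ᵢ = 𝐊ᵢᵀ Q 𝐊ᵢ`. -/
noncomputable def bigQ (i : Fin N) : Matrix (Fin N × Fin n) (Fin N × Fin n) ℝ :=
  (bigK N g.Γ i)ᵀ * g.Q * bigK N g.Γ i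

/-- `𝐐_{if} = 𝐊_{if}ᵀ Q_f 𝐊_{if}`. -/
noncomputable def bigQf (i : Fin N) : Matrix (Fin N × Fin n) (Fin N × Fin n) ℝ :=
  (bigK N g.Γf i)ᵀ * g.Qf * bigK N g.Γf i

variable {N} (P : Fin N → Matrix (Fin N × Fin n) (Fin N × Fin n) ℝ)

/-- `R + 𝐁ₖᵀ 𝐏ₖ 𝐁ₖ`. -/
def bigR (k : Fin N) : Matrix (Fin m) (Fin m) ℝ :=
  g.R + (g.bigB N k)ᵀ * P k * g.bigB N k

/-- `𝐁₀ᵀ 𝐏ₖ 𝐁₀`. -/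
noncomputable def bigS (k : Fin N) : Matrix (Fin m) (Fin m) ℝ :=
  (g.bigB₀ N)ᵀ * P k * g.bigB₀ N

/-- `I + ∑ₖ (R + 𝐁ₖᵀ 𝐏ₖ 𝐁ₖ)⁻¹ 𝐁₀ᵀ 𝐏ₖ 𝐁₀`. -/
noncomputable def bigI : Matrix (Fin m) (Fin m) ℝ :=
  1 + ∑ k, (g.bigR P k)⁻¹ * g.bigS P k

/-- `𝐌₀ = -[I + ∑ₖ (R + 𝐁ₖᵀ 𝐏ₖ 𝐁ₖ)⁻¹ 𝐁₀ᵀ 𝐏ₖ 𝐁₀]⁻¹ ∑ₖ (R + 𝐁ₖᵀ 𝐏ₖ 𝐁ₖ)⁻¹ 𝐁̂ₖᵀ 𝐏ₖ`. -/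
noncomputable def bigM₀ : Matrix (Fin m) (Fin N × Fin n) ℝ :=
  -((g.bigI P)⁻¹ * ∑ k, (g.bigR P k)⁻¹ * (g.bigBhat N k)ᵀ * P k)

/-- `𝐁₀ᵀ 𝐏ₖ 𝐁₀ 𝐌₀ + 𝐁̂ₖᵀ 𝐏ₖ`. -/
noncomputable def bigU (k : Fin N) : Matrix (Fin m) (Fin N × Fin n) ℝ :=
  g.bigS P k * g.bigM₀ P + (g.bigBhat N k)ᵀ * P k

/-- The right-hand side `Φᵢ(𝐏₁, …, 𝐏_N)` of the large Riccati equation `-𝐏̇ᵢ = Φᵢ`. -/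
noncomputable def bigPhi (i : Fin N) : Matrix (Fin N × Fin n) (Fin N × Fin n) ℝ :=
  P i * g.bigA N + (g.bigA N)ᵀ * P i + g.bigQ N i
    - P i * g.bigBhat N i * (g.bigR P i)⁻¹ * (g.bigBhat N i)ᵀ * P i
    + (g.bigM₀ P)ᵀ * g.bigS P i * (g.bigR P i)⁻¹ * g.bigS P i * g.bigM₀ P
    - P i * ∑ k ∈ Finset.univ.erase i, g.bigBhat N k * (g.bigR P k)⁻¹ * g.bigU P k
    - ∑ k ∈ Finset.univ.erase i, (g.bigU P k)ᵀ * (g.bigR P k)⁻¹ * (g.bigBhat N k)ᵀ * P i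
    + ∑ k ∈ Finset.univ.erase i, (g.bigU P k)ᵀ * (g.bigR P k)⁻¹ *
        ((g.bigB N k)ᵀ * P i * g.bigB N k) * (g.bigR P k)⁻¹ * g.bigU P k
    + (g.bigM₀ P)ᵀ * g.bigS P i * g.bigM₀ P

end BigSystem

/-- `(𝐏₁, …, 𝐏_N)` is a solution on `[0, T]` of the large Riccati system, including its
positivity and invertibility constraints. Derivatives at `0` and `T` are one-sided. -/
structure IsRiccatiSolution (N : ℕ)
    (P : Fin N → ℝ → Matrix (Fin N × Fin n) (Fin N × Fin n) ℝ) : Prop where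
  symm : ∀ i, ∀ t ∈ Icc 0 g.T, (P i t).IsSymm
  deriv : ∀ i, ∀ t ∈ Icc 0 g.T,
    HasDerivWithinAt (P i) (-g.bigPhi (fun k => P k t) i) (Icc 0 g.T) t
  terminal : ∀ i, P i g.T = g.bigQf N i
  posDef : ∀ i, ∀ t ∈ Icc 0 g.T, (g.bigR (fun k => P k t) i).PosDef
  posDef_add : ∀ i, ∀ t ∈ Icc 0 g.T,
    (g.bigR (fun k => P k t) i + g.bigS (fun k => P k t) i).PosDef
  isUnit : ∀ t ∈ Icc 0 g.T, IsUnit (g.bigI (fun k => P k t))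

/-- The `(j, l)` block, of size `n × n`, of an `Nn × Nn` matrix. -/
def block {N : ℕ} (X : Matrix (Fin N × Fin n) (Fin N × Fin n) ℝ) (j l : Fin N) :
    Matrix (Fin n) (Fin n) ℝ :=
  Matrix.of fun a b => X (j, a) (l, b)

/-- `|Π₁| + N |Π₂| + N² |Π₃| + N² |Π₄|`, where `Π₁, Π₂, Π₃, Π₄` are the blocks of `𝐏₁ = X` in the
positions `(1,1)`, `(1,2)`, `(2,2)`, `(2,3)`. -/
noncomputable def rescaledSize {N : ℕ} (hN : 3 ≤ N)
    (X : Matrix (Fin N × Fin n) (Fin N × Fin n) ℝ) : ℝ :=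
  euclNorm (block X ⟨0, by omega⟩ ⟨0, by omega⟩)
    + N * euclNorm (block X ⟨0, by omega⟩ ⟨1, by omega⟩)
    + (N : ℝ) ^ 2 * euclNorm (block X ⟨1, by omega⟩ ⟨1, by omega⟩)
    + (N : ℝ) ^ 2 * euclNorm (block X ⟨1, by omega⟩ ⟨2, by omega⟩)

/-- Asymptotic solvability. The four blocks `Π₁, …, Π₄` exist only for `N ≥ 3`, and the condition
becomes weaker as `N₀` grows, so `N₀ ≥ 3` is no restriction. -/
def AsymptoticallySolvable : Prop :=
  ∃ N₀ : ℕ, ∃ hN₀ : 3 ≤ N₀, ∃ c₀ : ℝ, 0 < c₀ ∧ ∃ C : ℝ, ∀ N : ℕ, ∀ hN : N₀ ≤ N,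
    ∃ P : Fin N → ℝ → Matrix (Fin N × Fin n) (Fin N × Fin n) ℝ,
      g.IsRiccatiSolution N P ∧
      (∀ t ∈ Icc 0 g.T, rescaledSize (hN₀.trans hN) (P ⟨0, by omega⟩ t) ≤ C) ∧
      (∀ i, ∀ t ∈ Icc 0 g.T,
        (g.bigR (fun k => P k t) i - c₀ • (1 : Matrix (Fin m) (Fin m) ℝ)).PosSemidef) ∧
      (∀ t ∈ Icc 0 g.T, IsUnit (g.bigI (fun k => P k t)))

/-- `𝓡₁(Z) = R + B₁ᵀ Z B₁`. -/
def R₁ (Z : Matrix (Fin n) (Fin n) ℝ) : Matrix (Fin m) (Fin m) ℝ :=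
  g.R + g.B₁ᵀ * Z * g.B₁

/-- `Ψ₁(Λ₁) = Λ₁ B H Bᵀ Λ₁ - Λ₁ A - Aᵀ Λ₁ - Q`, where `H = 𝓡₁(Λ₁)⁻¹`. -/
noncomputable def Ψ₁ (L₁ : Matrix (Fin n) (Fin n) ℝ) : Matrix (Fin n) (Fin n) ℝ :=
  L₁ * g.B * (g.R₁ L₁)⁻¹ * g.Bᵀ * L₁ - L₁ * g.A - g.Aᵀ * L₁ - g.Q

/-- `Ψ₂(Λ₁, Λ₂) = -Λ₁ G - Λ₂ (A + G) - Aᵀ Λ₂ + Λ₁ B H Bᵀ Λ₂ + Λ₂ B H Bᵀ Λ₁ + Λ₂ B H Bᵀ Λ₂ + Q Γ`,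
where `H = 𝓡₁(Λ₁)⁻¹`. -/
noncomputable def Ψ₂ (L₁ L₂ : Matrix (Fin n) (Fin n) ℝ) : Matrix (Fin n) (Fin n) ℝ :=
  -(L₁ * g.G) - L₂ * (g.A + g.G) - g.Aᵀ * L₂
    + L₁ * g.B * (g.R₁ L₁)⁻¹ * g.Bᵀ * L₂
    + L₂ * g.B * (g.R₁ L₁)⁻¹ * g.Bᵀ * L₁
    + L₂ * g.B * (g.R₁ L₁)⁻¹ * g.Bᵀ * L₂
    + g.Q * g.Γ

/-- `(Λ₁, Λ₂)` is a solution on `[0, T]` of the low-dimensional Riccati system, including the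
constraint `𝓡₁(Λ₁(t)) > 0`. -/
structure IsLimitSolution (L₁ L₂ : ℝ → Matrix (Fin n) (Fin n) ℝ) : Prop where
  symm : ∀ t ∈ Icc 0 g.T, (L₁ t).IsSymm
  deriv₁ : ∀ t ∈ Icc 0 g.T, HasDerivWithinAt L₁ (g.Ψ₁ (L₁ t)) (Icc 0 g.T) t
  terminal₁ : L₁ g.T = g.Qf
  posDef : ∀ t ∈ Icc 0 g.T, (g.R₁ (L₁ t)).PosDef
  deriv₂ : ∀ t ∈ Icc 0 g.T, HasDerivWithinAt L₂ (g.Ψ₂ (L₁ t) (L₂ t)) (Icc 0 g.T) t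
  terminal₂ : L₂ g.T = -(g.Qf * g.Γf)

end LQGame

/-!
Relabelling the players maps solutions of the large Riccati system to solutions, so by uniqueness
for ordinary differential equations a solution is exchangeable, and `𝐏₁, …, 𝐏_N` are determined by
the four blocks `Π₁, …, Π₄` of `𝐏₁`. With `h = 1 / N`, the rescaled blocks `Λ₁ = Π₁`, `Λ₂ = N Π₂`,
`Λ₃ = N² Π₃`, `Λ₄ = N² Π₄` solve a differential equation whose vector field and terminal value
are smooth in `h` up to `h = 0`. At `h = 0` the equations for `(Λ₁, Λ₂)` are the limit system, and
given `(Λ₁, Λ₂)` those for `(Λ₃, Λ₄)` are linear, hence globally solvable. Both implications are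
therefore persistence, under a small change of `h`, of a solution with values in a compact set:
from `h = 1 / N` to `h = 0` in one direction, from `h = 0` to `h = 1 / N` in the other.
-/

section ODE

open Metric Filter Topology
open scoped NNReal

variable {E : Type*} [NormedAddCommGroup E] [NormedSpace ℝ E]

/-- The radial retraction of a normed space onto the closed ball of radius `δ` around `0`. -/
noncomputable def radialRetraction (δ : ℝ) (y : E) : E := (δ / max δ ‖y‖) • y

theorem radialRetraction_of_norm_le {δ : ℝ} (hδ : 0 < δ) {y : E} (hy : ‖y‖ ≤ δ) :
    radialRetraction δ y = y := by
  rw [radialRetraction, max_eq_left hy, div_self hδ.ne', one_smul]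

theorem norm_radialRetraction_le {δ : ℝ} (hδ : 0 < δ) (y : E) : ‖radialRetraction δ y‖ ≤ δ := by
  have hm : 0 < max δ ‖y‖ := lt_max_of_lt_left hδ
  rw [radialRetraction, norm_smul, Real.norm_of_nonneg (by positivity), div_mul_eq_mul_div,
    div_le_iff₀ hm]
  exact mul_le_mul_of_nonneg_left (le_max_right _ _) hδ.le

theorem lipschitzWith_radialRetraction {δ : ℝ} (hδ : 0 < δ) :
    LipschitzWith 2 (radialRetraction δ : E → E) := by
  refine LipschitzWith.of_dist_le_mul fun x y => ?_
  set p := max δ ‖x‖ with hp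
  set q := max δ ‖y‖ with hq
  have hp0 : 0 < p := lt_max_of_lt_left hδ
  have hq0 : 0 < q := lt_max_of_lt_left hδ
  have hqp : |q - p| ≤ ‖x - y‖ := calc
    |q - p| ≤ |‖y‖ - ‖x‖| := by
      simpa only [hp, hq, max_comm δ] using abs_max_sub_max_le_abs ‖y‖ ‖x‖ δ
    _ ≤ ‖x - y‖ := (abs_norm_sub_norm_le y x).trans_eq (norm_sub_rev y x)
  have hδp : δ / p ≤ 1 := (div_le_one hp0).2 (le_max_left _ _)
  have hyq : ‖y‖ / q ≤ 1 := (div_le_one hq0).2 (le_max_right _ _)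
  have hsplit : radialRetraction δ x - radialRetraction δ y
      = (δ / p) • (x - y) + (δ / p * ((q - p) / q)) • y := by
    have : δ / p * ((q - p) / q) = δ / p - δ / q := by field_simp
    rw [this, radialRetraction, radialRetraction, ← hp, ← hq]
    module
  rw [dist_eq_norm, dist_eq_norm, hsplit]
  calc ‖(δ / p) • (x - y) + (δ / p * ((q - p) / q)) • y‖
      ≤ δ / p * ‖x - y‖ + δ / p * (|q - p| * (‖y‖ / q)) := by
        refine (norm_add_le _ _).trans_eq ?_
        simp only [norm_smul, norm_mul, norm_div, Real.norm_eq_abs, abs_of_pos hδ, abs_of_pos hp0,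
          abs_of_pos hq0]
        ring
    _ ≤ 1 * ‖x - y‖ + 1 * (‖x - y‖ * 1) := by gcongr
    _ = (2 : ℝ≥0) * ‖x - y‖ := by
        push_cast
        ring

/-- The time-dependent vector field `v`, frozen along rays outside the tube of radius `δ` around
the curve `z`. It extends `v` from the tube to the whole space, keeping it Lipschitz and making it
bounded. -/
noncomputable def tubeTruncation (v : ℝ → E → E) (z : ℝ → E) (δ t : ℝ) (x : E) : E :=
  v t (z t + radialRetraction δ (x - z t))

section TubeTruncation

variable {v : ℝ → E → E} {z : ℝ → E} {δ t : ℝ} {K : ℝ≥0} {I : Set ℝ} {x : E}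

theorem add_radialRetraction_mem_closedBall (hδ : 0 < δ) (y x : E) :
    y + radialRetraction δ (x - y) ∈ closedBall y δ := by
  simpa only [mem_closedBall, dist_self_add_left] using norm_radialRetraction_le hδ (x - y)

theorem tubeTruncation_of_mem (hδ : 0 < δ) (hx : x ∈ closedBall (z t) δ) :
    tubeTruncation v z δ t x = v t x := by
  rw [tubeTruncation, radialRetraction_of_norm_le hδ (mem_closedBall_iff_norm.1 hx),
    add_sub_cancel]

theorem lipschitzWith_tubeTruncation (hδ : 0 < δ)
    (hv : LipschitzOnWith K (v t) (closedBall (z t) δ)) :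
    LipschitzWith (K * 2) (tubeTruncation v z δ t) := by
  have hret : LipschitzWith 2 fun x => z t + radialRetraction δ (x - z t) :=
    LipschitzWith.of_dist_le_mul fun a b => by
      simpa only [dist_add_left, dist_sub_right] using
        (lipschitzWith_radialRetraction hδ).dist_le_mul (a - z t) (b - z t)
  rw [← lipschitzOnWith_univ] at hret ⊢
  exact hv.comp hret fun x _ => add_radialRetraction_mem_closedBall hδ (z t) x

theorem continuousOn_tubeTruncation (hδ : 0 < δ) (hz : ContinuousOn z I)
    (hv : ContinuousOn (Function.uncurry v) {p | p.1 ∈ I ∧ p.2 ∈ closedBall (z p.1) δ}) (x : E) :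
    ContinuousOn (tubeTruncation v z δ · x) I := by
  refine hv.comp (f := fun t => (t, z t + radialRetraction δ (x - z t))) ?_ fun t ht =>
    ⟨ht, add_radialRetraction_mem_closedBall hδ (z t) x⟩
  exact continuousOn_id.prodMk (hz.add
    ((lipschitzWith_radialRetraction hδ).continuous.comp_continuousOn (continuousOn_const.sub hz)))

theorem norm_tubeTruncation_le {M : ℝ} (hδ : 0 < δ) (hM : ‖v t (z t)‖ ≤ M)
    (hv : LipschitzOnWith K (v t) (closedBall (z t) δ)) (x : E) :
    ‖tubeTruncation v z δ t x‖ ≤ M + K * δ := by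
  have hmem := add_radialRetraction_mem_closedBall hδ (z t) x
  have hK : ‖tubeTruncation v z δ t x - v t (z t)‖ ≤ K * δ := calc
    _ ≤ K * ‖z t + radialRetraction δ (x - z t) - z t‖ :=
      hv.norm_sub_le hmem (mem_closedBall_self hδ.le)
    _ ≤ K * δ := by
      gcongr
      exact mem_closedBall_iff_norm.1 hmem
  linarith [norm_le_norm_add_norm_sub' (tubeTruncation v z δ t x) (v t (z t))]

end TubeTruncation

variable {a b : ℝ} {K : ℝ≥0} {v : ℝ → E → E} {ε δ : ℝ}

theorem exists_forall_hasDerivWithinAt_of_norm_le [CompleteSpace E] {M : ℝ} (t₀ : Icc a b) (x₀ : E)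
    (hv : ∀ t ∈ Icc a b, LipschitzWith K (v t)) (hc : ∀ x, ContinuousOn (v · x) (Icc a b))
    (hM : ∀ t ∈ Icc a b, ∀ x, ‖v t x‖ ≤ M) :
    ∃ x : ℝ → E, x t₀ = x₀ ∧ ∀ t ∈ Icc a b, HasDerivWithinAt x (v t (x t)) (Icc a b) t := by
  have hpl : IsPicardLindelof v t₀ x₀ (M.toNNReal * max (b - t₀).toNNReal (t₀ - a).toNNReal) 0
      M.toNNReal K :=
    { lipschitzOnWith := fun t ht => (hv t ht).lipschitzOnWith
      continuousOn := fun x _ => hc x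
      norm_le := fun t ht x _ => (hM t ht x).trans (Real.le_coe_toNNReal M)
      mul_max_le := by
        simp [Real.coe_toNNReal _ (sub_nonneg.2 t₀.2.1),
          Real.coe_toNNReal _ (sub_nonneg.2 t₀.2.2)] }
  exact hpl.exists_eq_forall_mem_Icc_hasDerivWithinAt₀

theorem dist_le_of_approx_trajectories_ODE_backward {x z x' z' : ℝ → E} {εx εz : ℝ}
    (hv : ∀ t ∈ Icc a b, LipschitzWith K (v t))
    (hx : ∀ t ∈ Icc a b, HasDerivWithinAt x (x' t) (Icc a b) t)
    (hx' : ∀ t ∈ Icc a b, dist (x' t) (v t (x t)) ≤ εx)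
    (hz : ∀ t ∈ Icc a b, HasDerivWithinAt z (z' t) (Icc a b) t)
    (hz' : ∀ t ∈ Icc a b, dist (z' t) (v t (z t)) ≤ εz) (hb : dist (x b) (z b) ≤ δ) :
    ∀ t ∈ Icc a b, dist (x t) (z t) ≤ gronwallBound δ K (εx + εz) (b - t) := by
  have hneg : MapsTo Neg.neg (Icc (-b) (-a)) (Icc a b) := fun t ht =>
    ⟨le_neg_of_le_neg ht.2, neg_le_of_neg_le ht.1⟩
  have hderiv {y : ℝ → E} {y' : E} {t : ℝ} (hy : HasDerivWithinAt y y' (Icc a b) (-t)) :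
      HasDerivWithinAt (y ∘ Neg.neg) (-y') (Icc (-b) (-a)) t := by
    simpa using hy.scomp t (hasDerivAt_neg t).hasDerivWithinAt hneg
  have hright {y : ℝ → E} {y' : E} {t : ℝ} (ht : t ∈ Ico (-b) (-a))
      (hy : HasDerivWithinAt y y' (Icc (-b) (-a)) t) : HasDerivWithinAt y y' (Ici t) t :=
    hy.mono_of_mem_nhdsWithin
      (mem_of_superset (Icc_mem_nhdsGE ht.2) (Icc_subset_Icc_left ht.1))
  intro t ht
  have := dist_le_of_approx_trajectories_ODE_of_mem (v := fun s y => -v (-s) y)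
    (s := fun _ => univ)
    (fun s hs => (hv _ (hneg (Ico_subset_Icc_self hs))).neg.lipschitzOnWith)
    (fun s hs => (hderiv (hx _ (hneg hs))).continuousWithinAt)
    (fun s hs => hright hs (hderiv (hx _ (hneg (Ico_subset_Icc_self hs)))))
    (fun s hs => (dist_neg_neg _ _).trans_le (hx' _ (hneg (Ico_subset_Icc_self hs))))
    (fun _ _ => mem_univ _)
    (fun s hs => (hderiv (hz _ (hneg hs))).continuousWithinAt)
    (fun s hs => hright hs (hderiv (hz _ (hneg (Ico_subset_Icc_self hs)))))
    (fun s hs => (dist_neg_neg _ _).trans_le (hz' _ (hneg (Ico_subset_Icc_self hs))))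
    (fun _ _ => mem_univ _) (by simpa using hb) (-t) ⟨neg_le_neg ht.2, neg_le_neg ht.1⟩
  simpa [sub_eq_neg_add, add_comm] using this

theorem exists_terminal_solution_near_approximate_solution [CompleteSpace E] {z z' : ℝ → E} {xb : E}
    (hab : a ≤ b) (hδ : 0 < δ) (hε : gronwallBound ε (K * 2) ε (b - a) ≤ δ)
    (hv : ∀ t ∈ Icc a b, LipschitzOnWith K (v t) (closedBall (z t) δ))
    (hc : ContinuousOn (Function.uncurry v) {p | p.1 ∈ Icc a b ∧ p.2 ∈ closedBall (z p.1) δ})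
    (hz : ∀ t ∈ Icc a b, HasDerivWithinAt z (z' t) (Icc a b) t)
    (hz' : ∀ t ∈ Icc a b, dist (z' t) (v t (z t)) ≤ ε) (hzb : dist xb (z b) ≤ ε) :
    ∃ x : ℝ → E, x b = xb ∧ (∀ t ∈ Icc a b, HasDerivWithinAt x (v t (x t)) (Icc a b) t) ∧
      ∀ t ∈ Icc a b, x t ∈ closedBall (z t) δ := by
  have hε0 : 0 ≤ ε := dist_nonneg.trans hzb
  have hzc : ContinuousOn z (Icc a b) := fun t ht => (hz t ht).continuousWithinAt
  have hself (t : ℝ) : z t ∈ closedBall (z t) δ := mem_closedBall_self hδ.le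
  obtain ⟨M, hM⟩ : ∃ M, ∀ t ∈ Icc a b, ‖v t (z t)‖ ≤ M :=
    isCompact_Icc.exists_bound_of_continuousOn
      (hc.comp (continuousOn_id.prodMk hzc) fun t ht => ⟨ht, hself t⟩)
  obtain ⟨x, hxb, hx⟩ := exists_forall_hasDerivWithinAt_of_norm_le ⟨b, hab, le_rfl⟩ xb
    (fun t ht => lipschitzWith_tubeTruncation hδ (hv t ht)) (continuousOn_tubeTruncation hδ hzc hc)
    (fun t ht => norm_tubeTruncation_le hδ (hM t ht) (hv t ht))
  have hnear : ∀ t ∈ Icc a b, x t ∈ closedBall (z t) δ := fun t ht => calc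
    dist (x t) (z t) ≤ gronwallBound ε (K * 2 : ℝ≥0) (0 + ε) (b - t) :=
      dist_le_of_approx_trajectories_ODE_backward
        (fun t ht => lipschitzWith_tubeTruncation hδ (hv t ht)) hx (fun t _ => (dist_self _).le) hz
        (fun t ht => by rw [tubeTruncation_of_mem hδ (hself t)]; exact hz' t ht)
        (by rwa [hxb]) t ht
    _ ≤ gronwallBound ε (K * 2) ε (b - a) := by
      rw [zero_add]
      exact gronwallBound_mono hε0 hε0 (K * 2).coe_nonneg (sub_le_sub_left ht.1 b)
    _ ≤ δ := hε
  refine ⟨x, hxb, fun t ht => ?_, hnear⟩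
  rw [← tubeTruncation_of_mem (v := v) hδ (hnear t ht)]
  exact hx t ht

theorem exists_terminal_solution_of_lipschitzWith [CompleteSpace E] (hab : a ≤ b)
    (hv : ∀ t ∈ Icc a b, LipschitzWith K (v t))
    (hc : ContinuousOn (Function.uncurry v) (Icc a b ×ˢ univ)) (xb : E) :
    ∃ x : ℝ → E, x b = xb ∧ ∀ t ∈ Icc a b, HasDerivWithinAt x (v t (x t)) (Icc a b) t := by
  obtain ⟨M, hM⟩ : ∃ M, ∀ t ∈ Icc a b, ‖v t 0‖ ≤ M :=
    isCompact_Icc.exists_bound_of_continuousOn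
      (hc.comp (f := fun t => (t, (0 : E))) (by fun_prop) fun t ht => ⟨ht, mem_univ _⟩)
  obtain ⟨x, hxb, hx, -⟩ := exists_terminal_solution_near_approximate_solution
    (ε := max M ‖xb‖) (z := 0) (z' := 0) (xb := xb) hab (lt_max_of_lt_left one_pos)
    (le_max_right 1 _) (fun t ht => (hv t ht).lipschitzOnWith)
    (hc.mono fun p hp => ⟨hp.1, mem_univ _⟩) (fun t _ => hasDerivWithinAt_const t _ 0)
    (fun t ht => by simpa [Pi.zero_apply] using Or.inl (hM t ht)) (by simp)
  exact ⟨x, hxb, hx⟩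

theorem exists_terminal_solution_of_linear [CompleteSpace E] {A : ℝ → E →L[ℝ] E} {f : ℝ → E}
    (hab : a ≤ b) (hA : ContinuousOn A (Icc a b)) (hf : ContinuousOn f (Icc a b)) (xb : E) :
    ∃ x : ℝ → E, x b = xb ∧ ∀ t ∈ Icc a b, HasDerivWithinAt x (A t (x t) + f t) (Icc a b) t := by
  obtain ⟨K, hK⟩ := isCompact_Icc.exists_bound_of_continuousOn hA
  refine exists_terminal_solution_of_lipschitzWith (K := K.toNNReal) (v := fun t y => A t y + f t)
    hab (fun t ht => ?_) ?_ xb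
  · refine LipschitzWith.of_dist_le_mul fun y y' => ?_
    rw [dist_add_right]
    exact ((A t).lipschitz.weaken (NNReal.le_toNNReal_of_coe_le (hK t ht))).dist_le_mul y y'
  · have hfst : MapsTo Prod.fst (Icc a b ×ˢ (univ : Set E)) (Icc a b) := fun p hp => hp.1
    exact ((hA.comp continuousOn_fst hfst).clm_apply continuousOn_snd).add
      (hf.comp continuousOn_fst hfst)

theorem exists_pos_gronwallBound_le (K x : ℝ) (hδ : 0 < δ) :
    ∃ ε > 0, gronwallBound ε K ε x ≤ δ := by
  have hlin (ε : ℝ) : gronwallBound ε K ε x = ε * gronwallBound 1 K 1 x := by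
    unfold gronwallBound
    split_ifs <;> ring
  have hlim : Tendsto (fun ε : ℝ => ε * gronwallBound 1 K 1 x) (𝓝[>] 0) (𝓝 0) :=
    ((continuous_id.mul continuous_const).tendsto' 0 0 (zero_mul _)).mono_left nhdsWithin_le_nhds
  obtain ⟨ε, hε, hε0⟩ := ((hlim.eventually_le_const hδ).and self_mem_nhdsWithin).exists
  exact ⟨ε, hε0, (hlin ε).trans_le hε⟩

theorem eventually_exists_terminal_solution_near [CompleteSpace E] {Θ : Type*}
    [PseudoMetricSpace Θ] {θ₀ : Θ} {F : Θ × E → E} {η : Θ → E} {r : ℝ} (hab : a ≤ b)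
    (hη : ContinuousAt η θ₀) (hr : 0 < r) (K : ℝ≥0) :
    ∀ᶠ θ in 𝓝 (θ₀, θ₀), ∀ z : ℝ → E, z b = η θ.1 →
      (∀ t ∈ Icc a b, HasDerivWithinAt z (F (θ.1, z t)) (Icc a b) t) →
      (∀ t ∈ Icc a b, LipschitzOnWith K F (ball (θ₀, z t) r)) →
      ∃ y : ℝ → E, y b = η θ.2 ∧
        (∀ t ∈ Icc a b, HasDerivWithinAt y (F (θ.2, y t)) (Icc a b) t) ∧
        ∀ t ∈ Icc a b, y t ∈ ball (z t) r := by
  obtain ⟨ε, hε, hgron⟩ := exists_pos_gronwallBound_le (K * 2) (b - a) (half_pos hr)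
  have hterm : ∀ᶠ θ : Θ × Θ in 𝓝 (θ₀, θ₀), dist (η θ.2) (η θ.1) < ε := by
    have : ContinuousAt (fun θ : Θ × Θ => dist (η θ.2) (η θ.1)) (θ₀, θ₀) :=
      (hη.comp' continuousAt_snd).dist (hη.comp' continuousAt_fst)
    exact this.eventually_lt_const (by simpa using hε)
  have hdist : ∀ᶠ θ : Θ × Θ in 𝓝 (θ₀, θ₀), K * dist θ.1 θ.2 < ε :=
    (Continuous.continuousAt (by fun_prop)).eventually_lt_const (by simpa using hε)
  filter_upwards [hterm, hdist, continuousAt_fst.eventually_mem (ball_mem_nhds θ₀ hr),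
    continuousAt_snd.eventually_mem (ball_mem_nhds θ₀ hr)] with θ hterm hdist hθ₁ hθ₂ z hzb hz hF
  have hball : ∀ {θ' : Θ} {t : ℝ} {x : E}, θ' ∈ ball θ₀ r → x ∈ closedBall (z t) (r / 2) →
      (θ', x) ∈ ball (θ₀, z t) r := fun hθ hx => by
    rw [← ball_prod_same]
    exact ⟨hθ, closedBall_subset_ball (half_lt_self hr) hx⟩
  have hself (t : ℝ) : z t ∈ closedBall (z t) (r / 2) := mem_closedBall_self (half_pos hr).le
  obtain ⟨y, hyb, hy, hyz⟩ := exists_terminal_solution_near_approximate_solution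
    (v := fun _ x => F (θ.2, x)) (xb := η θ.2) (K := K) hab (half_pos hr) hgron
    (fun t ht => by
      simpa only [mul_one, Function.comp_def] using (hF t ht).comp
        (LipschitzWith.prodMk_left θ.2).lipschitzOnWith fun x hx => hball hθ₂ hx)
    (fun p hp => by
      refine ContinuousAt.continuousWithinAt (ContinuousAt.comp' (g := F) ?_ (by fun_prop))
      exact (hF p.1 hp.1).continuousOn.continuousAt (isOpen_ball.mem_nhds (hball hθ₂ hp.2)))
    hz
    (fun t ht => calc
      dist (F (θ.1, z t)) (F (θ.2, z t)) ≤ K * dist (θ.1, z t) (θ.2, z t) :=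
        (hF t ht).dist_le_mul _ (hball hθ₁ (hself t)) _ (hball hθ₂ (hself t))
      _ ≤ ε := by simpa only [dist_prod_same_right] using hdist.le)
    (by rw [hzb]; exact hterm.le)
  exact ⟨y, hyb, hy, fun t ht => closedBall_subset_ball (half_lt_self hr) (hyz t ht)⟩

theorem eqOn_Icc_of_hasDerivWithinAt_of_contDiffAt {f : E → E} {x y : ℝ → E}
    (hx : ∀ t ∈ Icc a b, HasDerivWithinAt x (f (x t)) (Icc a b) t)
    (hy : ∀ t ∈ Icc a b, HasDerivWithinAt y (f (y t)) (Icc a b) t)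
    (hfx : ∀ t ∈ Icc a b, ContDiffAt ℝ 1 f (x t)) (hfy : ∀ t ∈ Icc a b, ContDiffAt ℝ 1 f (y t))
    (hb : x b = y b) : EqOn x y (Icc a b) := by
  have hxc : ContinuousOn x (Icc a b) := fun t ht => (hx t ht).continuousWithinAt
  have hyc : ContinuousOn y (Icc a b) := fun t ht => (hy t ht).continuousWithinAt
  have hf : LocallyLipschitzOn (x '' Icc a b ∪ y '' Icc a b) f := by
    rintro p hp
    obtain ⟨K, U, hU, hK⟩ : ∃ K, ∃ U ∈ 𝓝 p, LipschitzOnWith K f U := by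
      rcases hp with ⟨t, ht, rfl⟩ | ⟨t, ht, rfl⟩
      exacts [(hfx t ht).exists_lipschitzOnWith, (hfy t ht).exists_lipschitzOnWith]
    exact ⟨K, U, mem_nhdsWithin_of_mem_nhds hU, hK⟩
  obtain ⟨K, hK⟩ := hf.exists_lipschitzOnWith_of_compact
    ((isCompact_Icc.image_of_continuousOn hxc).union (isCompact_Icc.image_of_continuousOn hyc))
  have hleft {w w' : ℝ → E} (hw : ∀ t ∈ Icc a b, HasDerivWithinAt w (w' t) (Icc a b) t) :
      ∀ t ∈ Ioc a b, HasDerivWithinAt w (w' t) (Iic t) t := fun t ht =>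
    (hw t (Ioc_subset_Icc_self ht)).mono_of_mem_nhdsWithin
      (mem_of_superset (Icc_mem_nhdsLE ht.1) (Icc_subset_Icc_right ht.2))
  exact ODE_solution_unique_of_mem_Icc_left (fun _ _ => hK)
    hxc (hleft hx) (fun t ht => .inl (mem_image_of_mem x (Ioc_subset_Icc_self ht)))
    hyc (hleft hy) (fun t ht => .inr (mem_image_of_mem y (Ioc_subset_Icc_self ht))) hb

end ODE

section Compact

open Metric Filter Topology

theorem eventually_forall_ball_of_isCompact {X : Type*} [PseudoMetricSpace X] {s : Set X}
    (hs : IsCompact s) {Q : ℝ → Set X → Prop} (hQ : ∀ r, Antitone (Q r))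
    (h : ∀ x ∈ s, ∃ U ∈ 𝓝 x, ∀ᶠ r in 𝓝[>] 0, Q r U) :
    ∀ᶠ r in 𝓝[>] 0, ∀ x ∈ s, Q r (ball x r) := by
  have hloc : ∀ x ∈ s, ∀ᶠ p : ℝ × X in 𝓝[>] 0 ×ˢ 𝓝 x, Q p.1 (ball p.2 p.1) := by
    intro x hx
    obtain ⟨U, hU, hQU⟩ := h x hx
    obtain ⟨ρ, hρ, hρU⟩ := Metric.mem_nhds_iff.1 hU
    have hsmall : ∀ᶠ r : ℝ in 𝓝[>] 0, r < ρ / 2 :=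
      nhdsWithin_le_nhds (eventually_lt_nhds (half_pos hρ))
    filter_upwards [(hQU.and hsmall).prod_mk (ball_mem_nhds x (half_pos hρ))]
      with p ⟨⟨hQp, hp⟩, hpx⟩
    refine hQ p.1 (fun y hy => hρU ?_) hQp
    exact mem_ball.2 (by linarith [dist_triangle y p.2 x, mem_ball.1 hy, mem_ball.1 hpx])
  have : ∀ᶠ p : ℝ × X in 𝓝[>] 0 ×ˢ 𝓝ˢ s, Q p.1 (ball p.2 p.1) :=
    hs.mem_prod_nhdsSet_of_forall hloc
  exact this.curry.mono fun r hr => hr.self_of_nhdsSet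

end Compact

section MatrixAnalysis

open Filter Topology
open scoped Matrix.Norms.Frobenius

variable {E : Type*} [NormedAddCommGroup E] [NormedSpace ℝ E]
variable {a b c : Type*}

theorem hasDerivWithinAt_matrix [Finite b] {f : ℝ → Matrix a b ℝ} {f' : Matrix a b ℝ}
    {s : Set ℝ} {t : ℝ} :
    HasDerivWithinAt f f' s t ↔ ∀ i j, HasDerivWithinAt (fun u => f u i j) (f' i j) s t := by
  have := Fintype.ofFinite b
  exact (hasDerivWithinAt_pi (φ := (f : ℝ → a → b → ℝ))).trans <|
    forall_congr' fun _ => hasDerivWithinAt_pi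

theorem isSymm_of_hasDerivWithinAt [Finite a] {s : Set ℝ} (hs : Convex ℝ s)
    {X X' : ℝ → Matrix a a ℝ}
    (hX : ∀ t ∈ s, HasDerivWithinAt X (X' t) s t) (hX' : ∀ t ∈ s, (X' t).IsSymm) {t₀ t : ℝ}
    (ht₀ : t₀ ∈ s) (h₀ : (X t₀).IsSymm) (ht : t ∈ s) : (X t).IsSymm := by
  have := Fintype.ofFinite a
  have hXT : ∀ t ∈ s, HasDerivWithinAt (fun u => (X u)ᵀ - X u) 0 s t := fun t ht => by
    have h : HasDerivWithinAt (fun u => (X u)ᵀ) (X' t)ᵀ s t :=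
      hasDerivWithinAt_matrix.2 fun i j => hasDerivWithinAt_matrix.1 (hX t ht) j i
    have h' := h.fun_sub (hX t ht)
    rw [(hX' t ht).eq, sub_self] at h'
    exact h'
  have h := hs.norm_image_sub_le_of_norm_hasDerivWithin_le hXT (fun _ _ => norm_zero.le) ht₀ ht
  rw [h₀.eq, sub_self, sub_zero, zero_mul, norm_le_zero_iff, sub_eq_zero] at h
  exact h

variable [Fintype a] [Fintype b] [Fintype c]

@[fun_prop]
theorem contDiffAt_matrix_mul {k : WithTop ℕ∞} {f : E → Matrix a b ℝ} {g : E → Matrix b c ℝ} {x : E}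
    (hf : ContDiffAt ℝ k f x) (hg : ContDiffAt ℝ k g x) :
    ContDiffAt ℝ k (fun y => f y * g y) x :=
  have hmul : IsBoundedBilinearMap ℝ fun p : Matrix a b ℝ × Matrix b c ℝ => p.1 * p.2 :=
    { add_left := Matrix.add_mul
      smul_left := Matrix.smul_mul
      add_right := Matrix.mul_add
      smul_right := fun r X Y => Matrix.mul_smul X r Y
      bound := ⟨1, one_pos, fun X Y => by simpa only [one_mul] using frobenius_norm_mul X Y⟩ }
  hmul.contDiff.contDiffAt.comp x (hf.prodMk hg)

@[fun_prop]
theorem contDiffAt_matrix_transpose {k : WithTop ℕ∞} {f : E → Matrix a b ℝ} {x : E}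
    (hf : ContDiffAt ℝ k f x) : ContDiffAt ℝ k (fun y => (f y)ᵀ) x :=
  (transposeLinearEquiv a b ℝ ℝ).toLinearMap.toContinuousLinearMap.contDiff.contDiffAt.comp x hf

theorem contDiffAt_matrix_inv [DecidableEq a] {k : WithTop ℕ∞} {f : E → Matrix a a ℝ} {x : E}
    (hf : ContDiffAt ℝ k f x) (hx : IsUnit (f x)) : ContDiffAt ℝ k (fun y => (f y)⁻¹) x := by
  obtain ⟨u, hu⟩ := hx
  simp only [nonsing_inv_eq_ringInverse]
  exact (hu ▸ contDiffAt_ringInverse ℝ u : ContDiffAt ℝ k Ring.inverse (f x)).comp x hf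

end MatrixAnalysis

section SymmetricPart

variable {a : Type*}

/-- The symmetric part of a real square matrix. -/
noncomputable def symPart (X : Matrix a a ℝ) : Matrix a a ℝ :=
  (2 : ℝ)⁻¹ • (X + Xᵀ)

theorem isSymm_symPart (X : Matrix a a ℝ) : (symPart X).IsSymm := by
  simp only [IsSymm, symPart, transpose_smul, transpose_add, transpose_transpose, add_comm]

theorem symPart_of_isSymm {X : Matrix a a ℝ} (hX : X.IsSymm) : symPart X = X := by
  rw [symPart, hX.eq]
  module

theorem continuous_symPart : Continuous (symPart : Matrix a a ℝ → Matrix a a ℝ) := by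
  unfold symPart
  fun_prop

end SymmetricPart

section PositiveDefinite

open Filter Topology

variable {a : Type*}

theorem posDef_of_posSemidef_sub_smul_one [DecidableEq a] {M : Matrix a a ℝ} {r : ℝ} (hr : 0 < r)
    (h : (M - r • (1 : Matrix a a ℝ)).PosSemidef) : M.PosDef := by
  simpa only [add_sub_cancel] using (PosDef.one.smul hr).add_posSemidef h

theorem posSemidef_sub_smul_one_of_le [DecidableEq a] {M : Matrix a a ℝ} {r r' : ℝ}
    (h : (M - r • (1 : Matrix a a ℝ)).PosSemidef) (hr : r' ≤ r) :
    (M - r' • (1 : Matrix a a ℝ)).PosSemidef := by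
  convert h.add (PosSemidef.one.smul (sub_nonneg.2 hr)) using 1
  module

theorem isClosed_setOf_posSemidef [Finite a] : IsClosed {M : Matrix a a ℝ | M.PosSemidef} := by
  have := Fintype.ofFinite a
  simp only [posSemidef_iff_dotProduct_mulVec, ofPred_and, ofPred_forall, IsHermitian]
  refine (isClosed_eq (by fun_prop) continuous_id).inter (isClosed_iInter fun x => ?_)
  exact isClosed_le continuous_const (by fun_prop)

section

variable [DecidableEq a] {M : Matrix a a ℝ}

open scoped MatrixOrder Matrix.Norms.L2Operator

theorem exists_posSemidef_sub_smul_one [Finite a] (hM : M.PosDef) :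
    ∃ r > (0 : ℝ), (M - r • (1 : Matrix a a ℝ)).PosSemidef := by
  have := Fintype.ofFinite a
  cases subsingleton_or_nontrivial (Matrix a a ℝ) with
  | inl _ => exact ⟨1, one_pos, Subsingleton.elim 0 (M - _) ▸ .zero⟩
  | inr _ =>
    obtain ⟨r, hr, hrM⟩ := (CFC.exists_pos_algebraMap_le_iff (ha := hM.isHermitian)).2
      fun x hx => hM.isStrictlyPositive.spectrum_pos hx
    exact ⟨r, hr, by simpa only [Algebra.algebraMap_eq_smul_one] using le_iff.1 hrM⟩

theorem posSemidef_norm_smul_one_sub [Fintype a] (hM : M.IsHermitian) :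
    (‖M‖ • (1 : Matrix a a ℝ) - M).PosSemidef := by
  cases subsingleton_or_nontrivial (Matrix a a ℝ) with
  | inl _ => exact Subsingleton.elim 0 (_ - M) ▸ .zero
  | inr _ =>
    have : M ≤ algebraMap ℝ (Matrix a a ℝ) ‖M‖ := le_algebraMap_of_spectrum_le
      (fun x hx => (le_abs_self x).trans (spectrum.norm_le_norm_of_mem hx)) (ha := hM)
    simpa only [Algebra.algebraMap_eq_smul_one] using le_iff.1 this

theorem eventually_posSemidef_symPart_sub_smul_one [Finite a] (hM : M.PosDef) :
    ∃ r > (0 : ℝ), ∀ᶠ X in 𝓝 M, (symPart X - r • (1 : Matrix a a ℝ)).PosSemidef := by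
  have := Fintype.ofFinite a
  obtain ⟨r, hr, hMr⟩ := exists_posSemidef_sub_smul_one hM
  have hsymm : symPart M = M := symPart_of_isSymm hM.isHermitian
  have hnorm : Tendsto (fun X => ‖M - symPart X‖) (𝓝 M) (𝓝 0) := by
    simpa [hsymm] using ((continuous_const.sub continuous_symPart).norm.tendsto M :
      Tendsto (fun X => ‖M - symPart X‖) (𝓝 M) (𝓝 ‖M - symPart M‖))
  refine ⟨r / 2, half_pos hr, ?_⟩
  filter_upwards [hnorm.eventually (gt_mem_nhds (half_pos hr))] with X hX
  have h₁ : (‖M - symPart X‖ • (1 : Matrix a a ℝ) - (M - symPart X)).PosSemidef :=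
    posSemidef_norm_smul_one_sub (hM.isHermitian.sub (isSymm_symPart X))
  have h₂ : ((r / 2 - ‖M - symPart X‖) • (1 : Matrix a a ℝ)).PosSemidef :=
    PosSemidef.one.smul (sub_nonneg.2 hX.le)
  convert (hMr.add h₁).add h₂ using 1
  module

end

end PositiveDefinite

section Permutations

variable {α : Type*}

theorem exists_perm_pair {a b a' b' : α} (hab : a ≠ b) (hab' : a' ≠ b') :
    ∃ σ : Equiv.Perm α, σ a = a' ∧ σ b = b' := by
  obtain ⟨σ, hσ⟩ := Equiv.Perm.exists_extending_pair ![a, b] ![a', b']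
    (List.nodup_ofFn.1 (by simp [hab])) (List.nodup_ofFn.1 (by simp [hab']))
  exact ⟨σ, hσ 0, hσ 1⟩

theorem exists_perm_triple {a b c a' b' c' : α} (hab : a ≠ b) (hac : a ≠ c)
    (hbc : b ≠ c) (hab' : a' ≠ b') (hac' : a' ≠ c') (hbc' : b' ≠ c') :
    ∃ σ : Equiv.Perm α, σ a = a' ∧ σ b = b' ∧ σ c = c' := by
  obtain ⟨σ, hσ⟩ := Equiv.Perm.exists_extending_pair ![a, b, c] ![a', b', c']
    (List.nodup_ofFn.1 (by simp [hab, hac, hbc])) (List.nodup_ofFn.1 (by simp [hab', hac', hbc']))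
  exact ⟨σ, hσ 0, hσ 1, hσ 2⟩

end Permutations

section ConstantSums

variable {ι V : Type*} [Fintype ι] [AddCommGroup V] [Module ℝ V] {f : ι → V} {v : V}
  {i j l : ι}

theorem sum_erase_eq_sum_add_smul [DecidableEq ι] {t : Finset ι} (hit : i ∉ t)
    (h : ∀ k, k ≠ i → k ∉ t → f k = v) :
    ∑ k ∈ Finset.univ.erase i, f k = ∑ k ∈ t, f k + ((Fintype.card ι : ℝ) - (t.card + 1)) • v := by
  have ht : t ⊆ Finset.univ.erase i := fun k hk => by
    simpa using ne_of_mem_of_not_mem hk hit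
  have hsum : ∑ k ∈ Finset.univ.erase i \ t, f k = (Finset.univ.erase i \ t).card • v :=
    Finset.sum_eq_card_nsmul fun k hk => by
      rw [Finset.mem_sdiff, Finset.mem_erase] at hk
      exact h k hk.1.1 hk.2
  have hcard : (Finset.univ.erase i \ t).card + (t.card + 1) = Fintype.card ι := by
    rw [← add_assoc, Finset.card_sdiff_add_card_eq_card ht,
      Finset.card_erase_add_one (Finset.mem_univ i), Finset.card_univ]
  rw [← Finset.sum_sdiff ht, hsum, add_comm, ← Nat.cast_smul_eq_nsmul ℝ, ← hcard]
  push_cast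
  rw [add_sub_cancel_right]

theorem sum_erase_eq_smul [DecidableEq ι] (h : ∀ k, k ≠ i → f k = v) :
    ∑ k ∈ Finset.univ.erase i, f k = ((Fintype.card ι : ℝ) - 1) • v := by
  simpa using sum_erase_eq_sum_add_smul (Finset.notMem_empty i) fun k hk _ => h k hk

theorem sum_eq_add_smul (h : ∀ k, k ≠ i → f k = v) :
    ∑ k, f k = f i + ((Fintype.card ι : ℝ) - 1) • v := by
  classical
  rw [← Finset.add_sum_erase _ _ (Finset.mem_univ i), sum_erase_eq_smul h]

theorem sum_erase_eq_add_smul [DecidableEq ι] (hji : j ≠ i) (h : ∀ k, k ≠ i → k ≠ j → f k = v) :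
    ∑ k ∈ Finset.univ.erase i, f k = f j + ((Fintype.card ι : ℝ) - 2) • v := by
  rw [sum_erase_eq_sum_add_smul (t := {j}) (by simpa using hji.symm)
    fun k hki hkj => h k hki (by simpa using hkj)]
  norm_num

theorem sum_erase_eq_add_add_smul [DecidableEq ι] (hji : j ≠ i) (hli : l ≠ i) (hjl : j ≠ l)
    (h : ∀ k, k ≠ i → k ≠ j → k ≠ l → f k = v) :
    ∑ k ∈ Finset.univ.erase i, f k = f j + f l + ((Fintype.card ι : ℝ) - 3) • v := by
  have hf : ∀ k, k ≠ i → k ∉ ({j, l} : Finset ι) → f k = v := fun k hki hk => by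
    rw [Finset.mem_insert, Finset.mem_singleton, not_or] at hk
    exact h k hki hk.1 hk.2
  rw [sum_erase_eq_sum_add_smul (by simp [hji.symm, hli.symm]) hf, Finset.sum_pair hjl,
    Finset.card_pair hjl]
  norm_num

end ConstantSums

section Submatrix

theorem submatrix_mul_id {a b c d e : Type*} [Fintype c] (X : Matrix a c ℝ) (Y : Matrix c b ℝ)
    (f : d → a) (f' : e → b) :
    (X * Y).submatrix f f' = X.submatrix f id * Y.submatrix id f' := rfl

theorem sum_submatrix {ι a b d e : Type*} (s : Finset ι) (F : ι → Matrix a b ℝ) (f : d → a)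
    (f' : e → b) : (∑ k ∈ s, F k).submatrix f f' = ∑ k ∈ s, (F k).submatrix f f' := by
  ext
  simp only [submatrix_apply, Matrix.sum_apply]

end Submatrix

namespace LQGame

variable {n m N : ℕ} (g : LQGame n m)

section Symmetry

variable {P : Fin N → Matrix (Fin N × Fin n) (Fin N × Fin n) ℝ}

theorem isSymm_bigR (hR : g.R.IsSymm) {k : Fin N} (hP : (P k).IsSymm) : (g.bigR P k).IsSymm := by
  simp only [IsSymm, bigR, transpose_add, transpose_mul, transpose_transpose, hR.eq, hP.eq,
    Matrix.mul_assoc]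

theorem isSymm_bigS {k : Fin N} (hP : (P k).IsSymm) : (g.bigS P k).IsSymm := by
  simp only [IsSymm, bigS, transpose_mul, transpose_transpose, hP.eq, Matrix.mul_assoc]

theorem isSymm_bigQ (hQ : g.Q.IsSymm) (i : Fin N) : (g.bigQ N i).IsSymm := by
  simp only [IsSymm, bigQ, transpose_mul, transpose_transpose, hQ.eq, Matrix.mul_assoc]

theorem isSymm_bigPhi (hQ : g.Q.IsSymm) (hR : g.R.IsSymm) (hP : ∀ k, (P k).IsSymm) (i : Fin N) :
    (g.bigPhi P i).IsSymm := by
  have hH : ∀ k, ((g.bigR P k)⁻¹)ᵀ = (g.bigR P k)⁻¹ := fun k => by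
    rw [transpose_nonsing_inv, (g.isSymm_bigR hR (hP k)).eq]
  simp only [IsSymm, bigPhi, transpose_add, transpose_sub, transpose_mul, transpose_transpose,
    transpose_sum, hH, (g.isSymm_bigS (hP _)).eq, (g.isSymm_bigQ hQ i).eq, (hP _).eq,
    Matrix.mul_assoc, Matrix.mul_sum]
  abel

end Symmetry

section Permutation

variable (σ : Equiv.Perm (Fin N))

/-- The permutation of the coordinates of the joint state induced by a permutation of the
players. -/
def statePerm (n : ℕ) (σ : Equiv.Perm (Fin N)) : Fin N × Fin n ≃ Fin N × Fin n :=
  σ.prodCongr (Equiv.refl _)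

/-- The action of a permutation of the players on tuples of `Nn × Nn` matrices: both the players
and the coordinates of the joint state are renamed. -/
def relabel (P : Fin N → Matrix (Fin N × Fin n) (Fin N × Fin n) ℝ) :
    Fin N → Matrix (Fin N × Fin n) (Fin N × Fin n) ℝ :=
  fun i => (P (σ i)).submatrix (statePerm n σ) (statePerm n σ)

theorem submatrix_mul_statePerm {a b d e : Type*} (X : Matrix a (Fin N × Fin n) ℝ)
    (Y : Matrix (Fin N × Fin n) b ℝ) (f : d → a) (f' : e → b) :
    (X * Y).submatrix f f' = X.submatrix f (statePerm n σ) * Y.submatrix (statePerm n σ) f' :=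
  (submatrix_mul_equiv X Y f (statePerm n σ) f').symm

theorem sum_erase_submatrix {a b d e : Type*} (F : Fin N → Matrix a b ℝ) (f : d → a) (f' : e → b)
    (i : Fin N) :
    (∑ k ∈ Finset.univ.erase (σ i), F k).submatrix f f' =
      ∑ k ∈ Finset.univ.erase i, (F (σ k)).submatrix f f' := by
  rw [sum_submatrix]
  exact (Finset.sum_equiv σ (by simp) (by simp)).symm

theorem bigA_statePerm :
    (g.bigA N).submatrix (statePerm n σ) (statePerm n σ) = g.bigA N := by
  ext
  simp [bigA, statePerm]

theorem bigB₀_statePerm : (g.bigB₀ N).submatrix (statePerm n σ) id = g.bigB₀ N := by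
  ext
  simp [bigB₀, statePerm]

theorem bigBhat_statePerm (k : Fin N) :
    (g.bigBhat N (σ k)).submatrix (statePerm n σ) id = g.bigBhat N k := by
  ext
  simp [bigBhat, statePerm]

theorem bigB_statePerm (k : Fin N) :
    (g.bigB N (σ k)).submatrix (statePerm n σ) id = g.bigB N k := by
  ext
  simp [bigB, statePerm]

theorem bigK_statePerm (Θ : Matrix (Fin n) (Fin n) ℝ) (k : Fin N) :
    (bigK N Θ (σ k)).submatrix id (statePerm n σ) = bigK N Θ k := by
  ext
  simp [bigK, statePerm, Matrix.one_apply]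

theorem bigQ_relabel (k : Fin N) : relabel σ (g.bigQ N) k = g.bigQ N k := by
  simp only [relabel, bigQ, submatrix_mul_id, ← transpose_submatrix, submatrix_id_id,
    bigK_statePerm]

theorem bigQf_relabel (k : Fin N) : relabel σ (g.bigQf N) k = g.bigQf N k := by
  simp only [relabel, bigQf, submatrix_mul_id, ← transpose_submatrix, submatrix_id_id,
    bigK_statePerm]

variable (P : Fin N → Matrix (Fin N × Fin n) (Fin N × Fin n) ℝ)

theorem submatrix_statePerm (k : Fin N) :
    (P (σ k)).submatrix (statePerm n σ) (statePerm n σ) = relabel σ P k := rfl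

theorem bigR_relabel (k : Fin N) : g.bigR (relabel σ P) k = g.bigR P (σ k) := by
  rw [bigR, bigR, ← submatrix_id_id (_ * P (σ k) * _)]
  simp only [submatrix_mul_statePerm σ, ← transpose_submatrix, bigB_statePerm,
    submatrix_statePerm]

theorem bigS_relabel (k : Fin N) : g.bigS (relabel σ P) k = g.bigS P (σ k) := by
  rw [bigS, bigS, ← submatrix_id_id (_ * P (σ k) * _)]
  simp only [submatrix_mul_statePerm σ, ← transpose_submatrix, bigB₀_statePerm,
    submatrix_statePerm]

theorem bigI_relabel : g.bigI (relabel σ P) = g.bigI P := by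
  simp only [bigI, bigR_relabel, bigS_relabel]
  rw [Equiv.sum_comp σ fun k => (g.bigR P k)⁻¹ * g.bigS P k]

theorem bigM₀_relabel : g.bigM₀ (relabel σ P) = (g.bigM₀ P).submatrix id (statePerm n σ) := by
  have hsum : (∑ k, (g.bigR P k)⁻¹ * (g.bigBhat N k)ᵀ * P k).submatrix id (statePerm n σ) =
      ∑ k, (g.bigR (relabel σ P) k)⁻¹ * (g.bigBhat N k)ᵀ * relabel σ P k := by
    rw [sum_submatrix, ← Equiv.sum_comp σ]
    simp only [submatrix_mul_statePerm σ, submatrix_mul_id (c := Fin m), ← transpose_submatrix,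
      bigBhat_statePerm, submatrix_statePerm, bigR_relabel, submatrix_id_id]
  rw [bigM₀, bigM₀, submatrix_neg, Pi.neg_apply, Pi.neg_apply, submatrix_mul_id, submatrix_id_id,
    hsum, bigI_relabel]

theorem bigU_relabel (k : Fin N) :
    g.bigU (relabel σ P) k = (g.bigU P (σ k)).submatrix id (statePerm n σ) := by
  simp only [bigU, submatrix_add, Pi.add_apply, submatrix_mul_statePerm σ,
    submatrix_mul_id (c := Fin m), ← transpose_submatrix, submatrix_id_id, bigBhat_statePerm,
    submatrix_statePerm, bigS_relabel, bigM₀_relabel]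

theorem bigPhi_relabel (i : Fin N) :
    g.bigPhi (relabel σ P) i = relabel σ (g.bigPhi P) i := by
  simp only [← submatrix_statePerm σ (g.bigPhi P), bigPhi, submatrix_add, submatrix_sub,
    Pi.add_apply, Pi.sub_apply, submatrix_mul_statePerm σ, submatrix_mul_id (c := Fin m),
    ← transpose_submatrix, submatrix_id_id, sum_erase_submatrix, submatrix_statePerm,
    bigA_statePerm, bigQ_relabel, bigBhat_statePerm, bigB_statePerm, ← bigU_relabel,
    ← bigM₀_relabel, ← bigR_relabel, ← bigS_relabel]

end Permutation

section Exchangeability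

open scoped Matrix.Norms.Frobenius

/-- A symmetric tuple of `Nn × Nn` matrices that no permutation of the players changes. -/
structure IsExchangeable (P : Fin N → Matrix (Fin N × Fin n) (Fin N × Fin n) ℝ) : Prop where
  isSymm : ∀ i, (P i).IsSymm
  relabel_eq : ∀ σ : Equiv.Perm (Fin N), relabel σ P = P

theorem isExchangeable_bigQf (hQf : g.Qf.IsSymm) : IsExchangeable (g.bigQf N) where
  isSymm i := by
    simp only [IsSymm, bigQf, transpose_mul, transpose_transpose, hQf.eq, Matrix.mul_assoc]
  relabel_eq σ := funext (g.bigQf_relabel σ)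

theorem IsExchangeable.bigPhi {P : Fin N → Matrix (Fin N × Fin n) (Fin N × Fin n) ℝ}
    (hP : IsExchangeable P) (hQ : g.Q.IsSymm) (hR : g.R.IsSymm) :
    IsExchangeable (g.bigPhi P) where
  isSymm := g.isSymm_bigPhi hQ hR hP.isSymm
  relabel_eq σ := funext fun i => by rw [← bigPhi_relabel, hP.relabel_eq]

theorem contDiffAt_bigPhi {P : Fin N → Matrix (Fin N × Fin n) (Fin N × Fin n) ℝ}
    (hR : ∀ k, IsUnit (g.bigR P k)) (hI : IsUnit (g.bigI P)) :
    ContDiffAt ℝ 1 g.bigPhi P := by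
  have hH : ∀ k, ContDiffAt ℝ 1 (fun X => (g.bigR X k)⁻¹) P := fun k => by
    refine contDiffAt_matrix_inv ?_ (hR k)
    unfold bigR
    fun_prop
  have hS : ∀ k, ContDiffAt ℝ 1 (fun X => g.bigS X k) P := fun k => by
    unfold bigS
    fun_prop
  have hI' : ContDiffAt ℝ 1 (fun X => (g.bigI X)⁻¹) P := by
    refine contDiffAt_matrix_inv ?_ hI
    unfold bigI
    fun_prop
  have hM : ContDiffAt ℝ 1 (fun X => g.bigM₀ X) P := by
    unfold bigM₀
    fun_prop
  have hU : ∀ k, ContDiffAt ℝ 1 (fun X => g.bigU X k) P := fun k => by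
    unfold bigU
    fun_prop
  refine contDiffAt_pi.2 fun i => ?_
  unfold LQGame.bigPhi
  fun_prop

variable {g} in
theorem IsRiccatiSolution.isExchangeable
    {P : Fin N → ℝ → Matrix (Fin N × Fin n) (Fin N × Fin n) ℝ} (hP : g.IsRiccatiSolution N P)
    {t : ℝ} (ht : t ∈ Icc 0 g.T) : IsExchangeable fun k => P k t where
  isSymm i := hP.symm i t ht
  relabel_eq σ := by
    -- A relabelled solution is again a solution, with the same terminal value.
    suffices h : EqOn (fun t => relabel σ fun k => P k t) (fun t k => P k t) (Icc 0 g.T) from h ht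
    refine eqOn_Icc_of_hasDerivWithinAt_of_contDiffAt (f := -g.bigPhi) (fun t ht => ?_)
      (fun t ht => hasDerivWithinAt_pi.2 fun i => hP.deriv i t ht) (fun t ht => ?_)
      (fun t ht => ?_) ?_
    · refine hasDerivWithinAt_pi.2 fun i => hasDerivWithinAt_matrix.2 fun p q => ?_
      rw [Pi.neg_apply, Pi.neg_apply, bigPhi_relabel]
      exact hasDerivWithinAt_matrix.1 (hP.deriv (σ i) t ht) (statePerm n σ p) (statePerm n σ q)
    · refine (g.contDiffAt_bigPhi (fun k => ?_) ?_).neg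
      · rw [bigR_relabel]
        exact (hP.posDef (σ k) t ht).isUnit
      · rw [bigI_relabel]
        exact hP.isUnit t ht
    · exact (g.contDiffAt_bigPhi (fun k => (hP.posDef k t ht).isUnit) (hP.isUnit t ht)).neg
    · simp only [hP.terminal]
      exact funext (g.bigQf_relabel σ)

end Exchangeability

section Blocks

variable {a b : Type*}

theorem mul_eq_sum_blocks (X : Matrix a (Fin N × Fin n) ℝ) (Y : Matrix (Fin N × Fin n) b ℝ) :
    X * Y = ∑ k, X.submatrix id (Prod.mk k) * Y.submatrix (Prod.mk k) id := by
  ext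
  simp only [mul_apply, Matrix.sum_apply, Fintype.sum_prod_type, submatrix_apply, id_eq]

theorem mul_bigBhat (k : Fin N) (X : Matrix a (Fin N × Fin n) ℝ) :
    X * g.bigBhat N k = X.submatrix id (Prod.mk k) * g.B := by
  ext p q
  simp [bigBhat, mul_apply, Fintype.sum_prod_type, Finset.sum_ite_irrel]

theorem mul_bigB (k : Fin N) (X : Matrix a (Fin N × Fin n) ℝ) :
    X * g.bigB N k = X.submatrix id (Prod.mk k) * g.B₁ := by
  ext p q
  simp [bigB, mul_apply, Fintype.sum_prod_type, Finset.sum_ite_irrel]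

theorem mul_bigBhat_transpose_mul (k : Fin N) (Y : Matrix a (Fin m) ℝ)
    (X : Matrix (Fin N × Fin n) b ℝ) :
    Y * (g.bigBhat N k)ᵀ * X = Y * g.Bᵀ * X.submatrix (Prod.mk k) id := by
  have h := congrArg transpose (g.mul_bigBhat k Xᵀ)
  rw [transpose_mul, transpose_mul, transpose_transpose, transpose_submatrix,
    transpose_transpose] at h
  rw [Matrix.mul_assoc, h, Matrix.mul_assoc]

theorem mul_bigB_transpose_mul (k : Fin N) (Y : Matrix a (Fin m) ℝ)
    (X : Matrix (Fin N × Fin n) b ℝ) :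
    Y * (g.bigB N k)ᵀ * X = Y * g.B₁ᵀ * X.submatrix (Prod.mk k) id := by
  have h := congrArg transpose (g.mul_bigB k Xᵀ)
  rw [transpose_mul, transpose_mul, transpose_transpose, transpose_submatrix,
    transpose_transpose] at h
  rw [Matrix.mul_assoc, h, Matrix.mul_assoc]

theorem mul_bigB₀ (X : Matrix a (Fin N × Fin n) ℝ) :
    X * g.bigB₀ N = (N : ℝ)⁻¹ • ((∑ k, X.submatrix id (Prod.mk k)) * g.B₀) := by
  have h : ∀ k : Fin N, (g.bigB₀ N).submatrix (Prod.mk k) id = (N : ℝ)⁻¹ • g.B₀ := fun k => by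
    ext
    simp [bigB₀, div_eq_inv_mul]
  simp only [mul_eq_sum_blocks, h, Matrix.mul_smul, Matrix.sum_mul, Finset.smul_sum]

theorem bigB₀_transpose_mul (X : Matrix (Fin N × Fin n) b ℝ) :
    (g.bigB₀ N)ᵀ * X = (N : ℝ)⁻¹ • (g.B₀ᵀ * ∑ k, X.submatrix (Prod.mk k) id) := by
  have h := congrArg transpose (g.mul_bigB₀ Xᵀ)
  simpa only [transpose_smul, transpose_mul, transpose_sum, transpose_submatrix,
    transpose_transpose] using h

theorem mul_bigA_submatrix (X : Matrix a (Fin N × Fin n) ℝ) (l : Fin N) :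
    X * (g.bigA N).submatrix id (Prod.mk l) =
      X.submatrix id (Prod.mk l) * g.A +
        (N : ℝ)⁻¹ • ((∑ k, X.submatrix id (Prod.mk k)) * g.G) := by
  have h : ∀ k : Fin N, (g.bigA N).submatrix (Prod.mk k) (Prod.mk l) =
      (if k = l then g.A else 0) + (N : ℝ)⁻¹ • g.G := fun k => by
    ext p q
    by_cases hk : k = l <;> simp [bigA, div_eq_inv_mul, hk]
  simp only [mul_eq_sum_blocks, submatrix_submatrix, Function.id_comp, Function.comp_id, h,
    Matrix.mul_add, Finset.sum_add_distrib, Matrix.mul_smul, Matrix.sum_mul, Finset.smul_sum]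
  rw [Finset.sum_eq_single l (fun k _ hk => by rw [if_neg hk, Matrix.mul_zero]) (by simp),
    if_pos rfl]

theorem bigA_transpose_submatrix_mul (X : Matrix (Fin N × Fin n) b ℝ) (j : Fin N) :
    ((g.bigA N).submatrix id (Prod.mk j))ᵀ * X =
      g.Aᵀ * X.submatrix (Prod.mk j) id +
        (N : ℝ)⁻¹ • (g.Gᵀ * ∑ k, X.submatrix (Prod.mk k) id) := by
  have h := congrArg transpose (g.mul_bigA_submatrix Xᵀ j)
  simpa only [transpose_add, transpose_smul, transpose_mul, transpose_sum, transpose_submatrix,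
    transpose_transpose] using h

theorem bigK_submatrix (Θ : Matrix (Fin n) (Fin n) ℝ) (i j : Fin N) :
    (bigK N Θ i).submatrix id (Prod.mk j) = (if j = i then 1 else 0) - (N : ℝ)⁻¹ • Θ := by
  ext p q
  by_cases hj : j = i <;> simp [bigK, hj, div_eq_inv_mul]

theorem bigQ_submatrix (i j l : Fin N) :
    (g.bigQ N i).submatrix (Prod.mk j) (Prod.mk l) =
      ((if j = i then 1 else 0) - (N : ℝ)⁻¹ • g.Γ)ᵀ * g.Q *
        ((if l = i then 1 else 0) - (N : ℝ)⁻¹ • g.Γ) := by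
  simp only [bigQ, submatrix_mul_id, ← transpose_submatrix, bigK_submatrix, submatrix_id_id]

theorem bigQf_submatrix (i j l : Fin N) :
    (g.bigQf N i).submatrix (Prod.mk j) (Prod.mk l) =
      ((if j = i then 1 else 0) - (N : ℝ)⁻¹ • g.Γf)ᵀ * g.Qf *
        ((if l = i then 1 else 0) - (N : ℝ)⁻¹ • g.Γf) := by
  simp only [bigQf, submatrix_mul_id, ← transpose_submatrix, bigK_submatrix, submatrix_id_id]

variable (P : Fin N → Matrix (Fin N × Fin n) (Fin N × Fin n) ℝ)

theorem bigR_eq_block (k : Fin N) : g.bigR P k = g.R + g.B₁ᵀ * block (P k) k k * g.B₁ := by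
  rw [bigR, ← Matrix.one_mul (g.bigB N k)ᵀ, mul_bigB_transpose_mul, mul_bigB, Matrix.one_mul]
  rfl

theorem bigS_eq_sum_block (k : Fin N) :
    g.bigS P k = ((N : ℝ)⁻¹ ^ 2) • (g.B₀ᵀ * (∑ j, ∑ l, block (P k) j l) * g.B₀) := by
  rw [bigS, bigB₀_transpose_mul, Matrix.smul_mul, mul_bigB₀, smul_smul, sq]
  simp only [submatrix_mul_id, submatrix_id_id, sum_submatrix, ← Matrix.mul_sum]
  rw [Finset.sum_comm]
  rfl

theorem bigM₀_submatrix (j : Fin N) :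
    (g.bigM₀ P).submatrix id (Prod.mk j) =
      -((g.bigI P)⁻¹ * ∑ k, (g.bigR P k)⁻¹ * g.Bᵀ * block (P k) k j) := by
  simp only [bigM₀, submatrix_neg, Pi.neg_apply, submatrix_mul_id, submatrix_id_id, sum_submatrix,
    mul_bigBhat_transpose_mul, submatrix_submatrix, Function.id_comp, Function.comp_id]
  rfl

theorem bigU_submatrix (k j : Fin N) :
    (g.bigU P k).submatrix id (Prod.mk j) =
      g.bigS P k * (g.bigM₀ P).submatrix id (Prod.mk j) + g.Bᵀ * block (P k) k j := by
  rw [bigU, ← Matrix.one_mul (g.bigBhat N k)ᵀ, mul_bigBhat_transpose_mul, Matrix.one_mul]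
  simp only [submatrix_add, Pi.add_apply, submatrix_mul_id, submatrix_id_id]
  rfl

theorem bigPhi_submatrix (i j l : Fin N) :
    (g.bigPhi P i).submatrix (Prod.mk j) (Prod.mk l) =
      block (P i) j l * g.A + (N : ℝ)⁻¹ • ((∑ k, block (P i) j k) * g.G)
        + (g.Aᵀ * block (P i) j l + (N : ℝ)⁻¹ • (g.Gᵀ * ∑ k, block (P i) k l))
        + (g.bigQ N i).submatrix (Prod.mk j) (Prod.mk l)
        - block (P i) j i * g.B * (g.bigR P i)⁻¹ * g.Bᵀ * block (P i) i l
        + ((g.bigM₀ P).submatrix id (Prod.mk j))ᵀ * g.bigS P i * (g.bigR P i)⁻¹ * g.bigS P i *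
            (g.bigM₀ P).submatrix id (Prod.mk l)
        - ∑ k ∈ Finset.univ.erase i, block (P i) j k * g.B * (g.bigR P k)⁻¹ *
            (g.bigU P k).submatrix id (Prod.mk l)
        - ∑ k ∈ Finset.univ.erase i, ((g.bigU P k).submatrix id (Prod.mk j))ᵀ *
            (g.bigR P k)⁻¹ * g.Bᵀ * block (P i) k l
        + ∑ k ∈ Finset.univ.erase i, ((g.bigU P k).submatrix id (Prod.mk j))ᵀ *
            (g.bigR P k)⁻¹ * g.B₁ᵀ * block (P i) k k * g.B₁ * (g.bigR P k)⁻¹ *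
            (g.bigU P k).submatrix id (Prod.mk l)
        + ((g.bigM₀ P).submatrix id (Prod.mk j))ᵀ * g.bigS P i *
            (g.bigM₀ P).submatrix id (Prod.mk l) := by
  simp only [bigPhi, submatrix_add, submatrix_sub, Pi.add_apply, Pi.sub_apply, Matrix.mul_sum,
    sum_submatrix, ← Matrix.mul_assoc, submatrix_mul_id, submatrix_id_id, mul_bigBhat, mul_bigB,
    mul_bigBhat_transpose_mul, mul_bigB_transpose_mul, mul_bigA_submatrix,
    bigA_transpose_submatrix_mul, submatrix_submatrix, Function.id_comp, Function.comp_id,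
    ← transpose_submatrix]
  rfl

end Blocks

section Quad

/-- A quadruple `(Λ₁, Λ₂, Λ₃, Λ₄)` of `n × n` matrices: the rescaled blocks
`(Π₁, N Π₂, N² Π₃, N² Π₄)` of an exchangeable tuple. -/
abbrev Quad (n : ℕ) : Type :=
  Matrix (Fin n) (Fin n) ℝ × Matrix (Fin n) (Fin n) ℝ × Matrix (Fin n) (Fin n) ℝ ×
    Matrix (Fin n) (Fin n) ℝ

namespace Quad

variable (x : Quad n)

abbrev Λ₁ : Matrix (Fin n) (Fin n) ℝ := x.1

abbrev Λ₂ : Matrix (Fin n) (Fin n) ℝ := x.2.1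

abbrev Λ₃ : Matrix (Fin n) (Fin n) ℝ := x.2.2.1

abbrev Λ₄ : Matrix (Fin n) (Fin n) ℝ := x.2.2.2

end Quad

/-- The matrices `Λ₁, Λ₃, Λ₄` are symmetric, as they are for the rescaled blocks of an exchangeable
tuple. -/
structure Quad.IsSymm (x : Quad n) : Prop where
  isSymm₁ : x.Λ₁.IsSymm
  isSymm₃ : x.Λ₃.IsSymm
  isSymm₄ : x.Λ₄.IsSymm

/-- The rescaled blocks in the positions `(i, i)`, `(i, j)`, `(j, j)`, `(j, l)`. -/
noncomputable def quadOf (i j l : Fin N) (X : Matrix (Fin N × Fin n) (Fin N × Fin n) ℝ) : Quad n :=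
  (block X i i, (N : ℝ) • block X i j, ((N : ℝ) ^ 2) • block X j j, ((N : ℝ) ^ 2) • block X j l)

variable (x : Quad n)

/-- The `(j, l)` block of the `i`-th matrix of the exchangeable tuple with rescaled blocks `x`. -/
noncomputable def exchBlock (i j l : Fin N) : Matrix (Fin n) (Fin n) ℝ :=
  if j = i then if l = i then x.Λ₁ else (N : ℝ)⁻¹ • x.Λ₂
  else if l = i then (N : ℝ)⁻¹ • x.Λ₂ᵀ
  else if j = l then ((N : ℝ)⁻¹ ^ 2) • x.Λ₃ else ((N : ℝ)⁻¹ ^ 2) • x.Λ₄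

/-- The exchangeable tuple of `Nn × Nn` matrices with rescaled blocks `x`. -/
noncomputable def exch (i : Fin N) : Matrix (Fin N × Fin n) (Fin N × Fin n) ℝ :=
  Matrix.of fun p q => exchBlock x i p.1 q.1 p.2 q.2

theorem block_exch (i j l : Fin N) : block (exch x i) j l = exchBlock x i j l := rfl

theorem exchBlock_self (i : Fin N) : exchBlock x i i i = x.Λ₁ := by simp [exchBlock]

variable {i j l : Fin N}

theorem exchBlock_left (hl : l ≠ i) : exchBlock x i i l = (N : ℝ)⁻¹ • x.Λ₂ := by
  simp [exchBlock, hl]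

theorem exchBlock_right (hj : j ≠ i) : exchBlock x i j i = (N : ℝ)⁻¹ • x.Λ₂ᵀ := by
  simp [exchBlock, hj]

theorem exchBlock_diag (hj : j ≠ i) : exchBlock x i j j = ((N : ℝ)⁻¹ ^ 2) • x.Λ₃ := by
  simp [exchBlock, hj]

theorem exchBlock_off (hj : j ≠ i) (hl : l ≠ i) (hjl : j ≠ l) :
    exchBlock x i j l = ((N : ℝ)⁻¹ ^ 2) • x.Λ₄ := by
  simp [exchBlock, hj, hl, hjl]

theorem quadOf_exch (hji : j ≠ i) (hli : l ≠ i) (hjl : j ≠ l) :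
    quadOf i j l (exch x i) = x := by
  have hN : (N : ℝ) ≠ 0 := Nat.cast_ne_zero.2 i.pos.ne'
  simp only [quadOf, block_exch, exchBlock_self, exchBlock_left x hji, exchBlock_diag x hji,
    exchBlock_off x hji hli hjl, inv_pow, smul_inv_smul₀ hN, smul_inv_smul₀ (pow_ne_zero 2 hN)]

variable {x}

theorem isExchangeable_exch (hx : x.IsSymm) : IsExchangeable (exch x : Fin N → _) where
  isSymm i := by
    have h : ∀ j l : Fin N, (exchBlock x i j l)ᵀ = exchBlock x i l j := fun j l => by
      by_cases hj : j = i <;> by_cases hl : l = i <;> by_cases hjl : j = l <;>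
        simp_all [exchBlock, hx.isSymm₁.eq, hx.isSymm₃.eq, hx.isSymm₄.eq, eq_comm]
    ext p q
    exact congrFun (congrFun (h q.1 p.1) p.2) q.2
  relabel_eq σ := by
    ext i p q
    simp [relabel, statePerm, exch, exchBlock]

end Quad

section Determined

variable {P P' : Fin N → Matrix (Fin N × Fin n) (Fin N × Fin n) ℝ} {i j l : Fin N}

namespace IsExchangeable

theorem block_apply (hP : IsExchangeable P) (σ : Equiv.Perm (Fin N)) (i j l : Fin N) :
    block (P (σ i)) (σ j) (σ l) = block (P i) j l := by
  conv_rhs => rw [← hP.relabel_eq σ]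
  rfl

theorem transpose_block (hP : IsExchangeable P) (i j l : Fin N) :
    (block (P i) j l)ᵀ = block (P i) l j :=
  congrArg (block · l j) (hP.isSymm i)

theorem isSymm_block_off (hP : IsExchangeable P) (hji : j ≠ i) (hli : l ≠ i) :
    (block (P i) j l).IsSymm := by
  have h := hP.block_apply (Equiv.swap j l) i j l
  rw [Equiv.swap_apply_of_ne_of_ne hji.symm hli.symm, Equiv.swap_apply_left,
    Equiv.swap_apply_right] at h
  exact (hP.transpose_block i j l).trans h

theorem isSymm_quadOf (hP : IsExchangeable P) (hji : j ≠ i) (hli : l ≠ i) :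
    (quadOf i j l (P i)).IsSymm where
  isSymm₁ := hP.transpose_block i i i
  isSymm₃ := IsSymm.smul (hP.transpose_block i j j) _
  isSymm₄ := (hP.isSymm_block_off hji hli).smul _

end IsExchangeable

theorem IsExchangeable.ext (hP : IsExchangeable P) (hP' : IsExchangeable P') (hji : j ≠ i)
    (hli : l ≠ i) (hjl : j ≠ l) (h : quadOf i j l (P i) = quadOf i j l (P' i)) : P = P' := by
  have hN : (N : ℝ) ≠ 0 := Nat.cast_ne_zero.2 i.pos.ne'
  obtain ⟨hii, hij, hjj, hjl'⟩ :
      block (P i) i i = block (P' i) i i ∧ block (P i) i j = block (P' i) i j ∧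
        block (P i) j j = block (P' i) j j ∧ block (P i) j l = block (P' i) j l := by
    simpa only [quadOf, Prod.mk.injEq, (smul_right_injective _ hN).eq_iff,
      (smul_right_injective _ (pow_ne_zero 2 hN)).eq_iff] using h
  have hrow : ∀ k q, block (P k) k q = block (P' k) k q := fun k q => by
    rcases eq_or_ne q k with rfl | hq
    · obtain ⟨σ, rfl⟩ : ∃ σ : Equiv.Perm (Fin N), σ i = q :=
      ⟨Equiv.swap i q, Equiv.swap_apply_left i q⟩
      rw [hP.block_apply, hP'.block_apply, hii]
    · obtain ⟨σ, rfl, rfl⟩ := exists_perm_pair hji.symm hq.symm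
      rw [hP.block_apply, hP'.block_apply, hij]
  have hblock : ∀ k p q, block (P k) p q = block (P' k) p q := fun k p q => by
    rcases eq_or_ne p k with rfl | hp
    · exact hrow p q
    rcases eq_or_ne q k with rfl | hq
    · rw [← hP.transpose_block, ← hP'.transpose_block, hrow]
    rcases eq_or_ne p q with rfl | hpq
    · obtain ⟨σ, rfl, rfl⟩ := exists_perm_pair hji.symm hp.symm
      rw [hP.block_apply, hP'.block_apply, hjj]
    · obtain ⟨σ, rfl, rfl, rfl⟩ :=
        exists_perm_triple hji.symm hli.symm hjl hp.symm hq.symm hpq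
      rw [hP.block_apply, hP'.block_apply, hjl']
  ext k p q
  exact congrFun (congrFun (hblock k p.1 q.1) p.2) q.2

theorem IsExchangeable.exch_quadOf (hP : IsExchangeable P) (hji : j ≠ i) (hli : l ≠ i)
    (hjl : j ≠ l) : exch (quadOf i j l (P i)) = P :=
  (isExchangeable_exch (hP.isSymm_quadOf hji hli)).ext hP hji hli hjl
    (quadOf_exch _ hji hli hjl)

end Determined

section ReducedField

variable (h : ℝ) (x : Quad n)

/-- `N²` times the sum of all blocks of an exchangeable matrix, conjugated by `B₀`; here and below
`h` stands for `1 / N`. -/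
noncomputable def redS : Matrix (Fin m) (Fin m) ℝ :=
  g.B₀ᵀ * (x.Λ₁ + (1 - h) • (x.Λ₂ + x.Λ₂ᵀ) + (h * (1 - h)) • x.Λ₃
    + ((1 - h) * (1 - 2 * h)) • x.Λ₄) * g.B₀

/-- The matrix `𝐈₀` of an exchangeable tuple. -/
noncomputable def redI : Matrix (Fin m) (Fin m) ℝ :=
  1 + h • ((g.R₁ x.Λ₁)⁻¹ * g.redS h x)

/-- The common block of `𝐌₀` of an exchangeable tuple. -/
noncomputable def redM : Matrix (Fin m) (Fin n) ℝ :=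
  -((g.redI h x)⁻¹ * ((g.R₁ x.Λ₁)⁻¹ * g.Bᵀ * (x.Λ₁ + (1 - h) • x.Λ₂)))

/-- The `k`-th block of `𝐔ₖ` of an exchangeable tuple. -/
noncomputable def redU : Matrix (Fin m) (Fin n) ℝ :=
  g.Bᵀ * x.Λ₁ + h ^ 2 • (g.redS h x * g.redM h x)

/-- `N` times the other blocks of `𝐔ₖ` of an exchangeable tuple. -/
noncomputable def redW : Matrix (Fin m) (Fin n) ℝ :=
  g.Bᵀ * x.Λ₂ + h • (g.redS h x * g.redM h x)

/-- `N²` times the quadratic form that weighs the controls of the other players. -/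
noncomputable def redX : Matrix (Fin m) (Fin m) ℝ :=
  (g.R₁ x.Λ₁)⁻¹ * (g.B₁ᵀ * x.Λ₃ * g.B₁) * (g.R₁ x.Λ₁)⁻¹

/-- The rescaled `(1, 1)` block of the right-hand side of the large Riccati system. -/
noncomputable def redPhi₁ : Matrix (Fin n) (Fin n) ℝ :=
  x.Λ₁ * g.A + h • ((x.Λ₁ + (1 - h) • x.Λ₂) * g.G)
    + (g.Aᵀ * x.Λ₁ + h • (g.Gᵀ * (x.Λ₁ + (1 - h) • x.Λ₂ᵀ)))
    + (1 - h • g.Γ)ᵀ * g.Q * (1 - h • g.Γ)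
    - x.Λ₁ * g.B * (g.R₁ x.Λ₁)⁻¹ * g.Bᵀ * x.Λ₁
    + h ^ 4 • ((g.redM h x)ᵀ * g.redS h x * (g.R₁ x.Λ₁)⁻¹ * g.redS h x * g.redM h x)
    - (h * (1 - h)) • (x.Λ₂ * g.B * (g.R₁ x.Λ₁)⁻¹ * g.redW h x)
    - (h * (1 - h)) • ((g.redW h x)ᵀ * (g.R₁ x.Λ₁)⁻¹ * g.Bᵀ * x.Λ₂ᵀ)
    + (h ^ 3 * (1 - h)) • ((g.redW h x)ᵀ * g.redX x * g.redW h x)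
    + h ^ 2 • ((g.redM h x)ᵀ * g.redS h x * g.redM h x)

/-- The rescaled `(1, 2)` block of the right-hand side of the large Riccati system. -/
noncomputable def redPhi₂ : Matrix (Fin n) (Fin n) ℝ :=
  x.Λ₂ * g.A + (x.Λ₁ + (1 - h) • x.Λ₂) * g.G
    + (g.Aᵀ * x.Λ₂ + h • (g.Gᵀ * (x.Λ₂ + h • x.Λ₃ + (1 - 2 * h) • x.Λ₄)))
    - (1 - h • g.Γ)ᵀ * g.Q * g.Γ
    - x.Λ₁ * g.B * (g.R₁ x.Λ₁)⁻¹ * g.Bᵀ * x.Λ₂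
    + h ^ 3 • ((g.redM h x)ᵀ * g.redS h x * (g.R₁ x.Λ₁)⁻¹ * g.redS h x * g.redM h x)
    - x.Λ₂ * g.B * (g.R₁ x.Λ₁)⁻¹ * (g.redU h x + (1 - 2 * h) • g.redW h x)
    - h • ((g.redW h x)ᵀ * (g.R₁ x.Λ₁)⁻¹ * g.Bᵀ * (h • x.Λ₃ + (1 - 2 * h) • x.Λ₄))
    + h ^ 2 • ((g.redW h x)ᵀ * g.redX x * (g.redU h x + (1 - 2 * h) • g.redW h x))
    + h • ((g.redM h x)ᵀ * g.redS h x * g.redM h x)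

/-- The part that the rescaled `(2, 2)` and `(2, 3)` blocks of the right-hand side of the large
Riccati system have in common. -/
noncomputable def redPhiCommon : Matrix (Fin n) (Fin n) ℝ :=
  (x.Λ₂ᵀ + h • x.Λ₃ + (1 - 2 * h) • x.Λ₄) * g.G
    + g.Gᵀ * (x.Λ₂ + h • x.Λ₃ + (1 - 2 * h) • x.Λ₄)
    + g.Γᵀ * g.Q * g.Γ
    - x.Λ₂ᵀ * g.B * (g.R₁ x.Λ₁)⁻¹ * g.Bᵀ * x.Λ₂
    + h ^ 2 • ((g.redM h x)ᵀ * g.redS h x * (g.R₁ x.Λ₁)⁻¹ * g.redS h x * g.redM h x)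
    + (g.redM h x)ᵀ * g.redS h x * g.redM h x

/-- The rescaled `(2, 2)` block of the right-hand side of the large Riccati system. -/
noncomputable def redPhi₃ : Matrix (Fin n) (Fin n) ℝ :=
  x.Λ₃ * g.A + g.Aᵀ * x.Λ₃ + g.redPhiCommon h x
    - (x.Λ₃ * g.B * (g.R₁ x.Λ₁)⁻¹ * g.redU h x
      + (1 - 2 * h) • (x.Λ₄ * g.B * (g.R₁ x.Λ₁)⁻¹ * g.redW h x))
    - ((g.redU h x)ᵀ * (g.R₁ x.Λ₁)⁻¹ * g.Bᵀ * x.Λ₃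
      + (1 - 2 * h) • ((g.redW h x)ᵀ * (g.R₁ x.Λ₁)⁻¹ * g.Bᵀ * x.Λ₄))
    + ((g.redU h x)ᵀ * g.redX x * g.redU h x
      + (h * (1 - 2 * h)) • ((g.redW h x)ᵀ * g.redX x * g.redW h x))

/-- The rescaled `(2, 3)` block of the right-hand side of the large Riccati system. -/
noncomputable def redPhi₄ : Matrix (Fin n) (Fin n) ℝ :=
  x.Λ₄ * g.A + g.Aᵀ * x.Λ₄ + g.redPhiCommon h x
    - (h • (x.Λ₃ * g.B * (g.R₁ x.Λ₁)⁻¹ * g.redW h x)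
      + x.Λ₄ * g.B * (g.R₁ x.Λ₁)⁻¹ * g.redU h x
      + (1 - 3 * h) • (x.Λ₄ * g.B * (g.R₁ x.Λ₁)⁻¹ * g.redW h x))
    - ((g.redU h x)ᵀ * (g.R₁ x.Λ₁)⁻¹ * g.Bᵀ * x.Λ₄
      + h • ((g.redW h x)ᵀ * (g.R₁ x.Λ₁)⁻¹ * g.Bᵀ * x.Λ₃)
      + (1 - 3 * h) • ((g.redW h x)ᵀ * (g.R₁ x.Λ₁)⁻¹ * g.Bᵀ * x.Λ₄))
    + h • ((g.redU h x)ᵀ * g.redX x * g.redW h x + (g.redW h x)ᵀ * g.redX x * g.redU h x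
      + (1 - 3 * h) • ((g.redW h x)ᵀ * g.redX x * g.redW h x))

/-- The rescaled blocks of the right-hand side of the large Riccati system, as a function of
`h = 1 / N` and of the rescaled blocks of an exchangeable tuple. -/
noncomputable def redPhi : Quad n :=
  (g.redPhi₁ h x, g.redPhi₂ h x, g.redPhi₃ h x, g.redPhi₄ h x)

/-- The rescaled blocks of the terminal value of the large Riccati system, with `h = 1 / N`. -/
noncomputable def redTerminal : Quad n :=
  ((1 - h • g.Γf)ᵀ * g.Qf * (1 - h • g.Γf), -((1 - h • g.Γf)ᵀ * g.Qf * g.Γf),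
    g.Γfᵀ * g.Qf * g.Γf, g.Γfᵀ * g.Qf * g.Γf)

end ReducedField

section Reduction

variable (x : Quad n) {i j l : Fin N}

theorem sum_exchBlock_left (i : Fin N) :
    ∑ k, exchBlock x i i k = x.Λ₁ + (1 - (N : ℝ)⁻¹) • x.Λ₂ := by
  have hN : (N : ℝ) ≠ 0 := Nat.cast_ne_zero.2 i.pos.ne'
  rw [sum_eq_add_smul fun k hk => exchBlock_left x hk, exchBlock_self, Fintype.card_fin]
  match_scalars <;> field_simp

theorem sum_exchBlock_right (i : Fin N) :
    ∑ k, exchBlock x i k i = x.Λ₁ + (1 - (N : ℝ)⁻¹) • x.Λ₂ᵀ := by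
  have hN : (N : ℝ) ≠ 0 := Nat.cast_ne_zero.2 i.pos.ne'
  rw [sum_eq_add_smul fun k hk => exchBlock_right x hk, exchBlock_self, Fintype.card_fin]
  match_scalars <;> field_simp

theorem sum_exchBlock_row (hj : j ≠ i) :
    ∑ k, exchBlock x i j k = (N : ℝ)⁻¹ •
      (x.Λ₂ᵀ + (N : ℝ)⁻¹ • x.Λ₃ + (1 - 2 * (N : ℝ)⁻¹) • x.Λ₄) := by
  have hN : (N : ℝ) ≠ 0 := Nat.cast_ne_zero.2 i.pos.ne'
  rw [← Finset.add_sum_erase _ _ (Finset.mem_univ i), sum_erase_eq_add_smul hj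
    fun k hki hkj => exchBlock_off x hj hki hkj.symm, exchBlock_right x hj, exchBlock_diag x hj,
    Fintype.card_fin]
  match_scalars <;> field_simp

theorem sum_exchBlock_col (hl : l ≠ i) :
    ∑ k, exchBlock x i k l = (N : ℝ)⁻¹ •
      (x.Λ₂ + (N : ℝ)⁻¹ • x.Λ₃ + (1 - 2 * (N : ℝ)⁻¹) • x.Λ₄) := by
  have hN : (N : ℝ) ≠ 0 := Nat.cast_ne_zero.2 i.pos.ne'
  rw [← Finset.add_sum_erase _ _ (Finset.mem_univ i), sum_erase_eq_add_smul hl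
    fun k hki hkl => exchBlock_off x hki hl hkl, exchBlock_left x hl, exchBlock_diag x hl,
    Fintype.card_fin]
  match_scalars <;> field_simp

theorem sum_exchBlock_self_col (j : Fin N) :
    ∑ k, exchBlock x k k j = x.Λ₁ + (1 - (N : ℝ)⁻¹) • x.Λ₂ := by
  have hN : (N : ℝ) ≠ 0 := Nat.cast_ne_zero.2 j.pos.ne'
  rw [sum_eq_add_smul fun k hk => exchBlock_left x (Ne.symm hk), exchBlock_self, Fintype.card_fin]
  match_scalars <;> field_simp

theorem bigR_exch (k : Fin N) : g.bigR (exch x) k = g.R₁ x.Λ₁ := by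
  rw [bigR_eq_block, block_exch, exchBlock_self, R₁]

theorem bigS_exch (k : Fin N) : g.bigS (exch x) k = ((N : ℝ)⁻¹ ^ 2) • g.redS (N : ℝ)⁻¹ x := by
  have hN : (N : ℝ) ≠ 0 := Nat.cast_ne_zero.2 k.pos.ne'
  have hsum : ∑ j, ∑ l, exchBlock x k j l = x.Λ₁ + (1 - (N : ℝ)⁻¹) • (x.Λ₂ + x.Λ₂ᵀ)
      + ((N : ℝ)⁻¹ * (1 - (N : ℝ)⁻¹)) • x.Λ₃
      + ((1 - (N : ℝ)⁻¹) * (1 - 2 * (N : ℝ)⁻¹)) • x.Λ₄ := by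
    rw [sum_eq_add_smul fun j hj => sum_exchBlock_row x hj, sum_exchBlock_left, Fintype.card_fin]
    match_scalars <;> field_simp
  simp only [bigS_eq_sum_block, block_exch, hsum, redS]

theorem bigI_exch (hN : N ≠ 0) : g.bigI (exch x : Fin N → _) = g.redI (N : ℝ)⁻¹ x := by
  have hN : (N : ℝ) ≠ 0 := Nat.cast_ne_zero.2 hN
  simp only [bigI, bigR_exch, bigS_exch, redI, Finset.sum_const, Finset.card_univ,
    Fintype.card_fin, Matrix.mul_smul, ← Nat.cast_smul_eq_nsmul ℝ, smul_smul]
  congr 2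
  field_simp

theorem bigM₀_exch (j : Fin N) :
    (g.bigM₀ (exch x : Fin N → _)).submatrix id (Prod.mk j) = g.redM (N : ℝ)⁻¹ x := by
  simp only [bigM₀_submatrix, g.bigI_exch x j.pos.ne', bigR_exch, block_exch, ← Matrix.mul_sum,
    sum_exchBlock_self_col, redM]

theorem bigU_exch_self (k : Fin N) :
    (g.bigU (exch x : Fin N → _) k).submatrix id (Prod.mk k) = g.redU (N : ℝ)⁻¹ x := by
  rw [bigU_submatrix, bigS_exch, bigM₀_exch, block_exch, exchBlock_self, redU, Matrix.smul_mul,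
    add_comm]

theorem bigU_exch_ne {k : Fin N} (hj : j ≠ k) :
    (g.bigU (exch x : Fin N → _) k).submatrix id (Prod.mk j) =
      (N : ℝ)⁻¹ • g.redW (N : ℝ)⁻¹ x := by
  rw [bigU_submatrix, bigS_exch, bigM₀_exch, block_exch, exchBlock_left x hj, redW, Matrix.mul_smul,
    Matrix.smul_mul]
  module

theorem block_bigPhi_exch_self (i : Fin N) :
    block (g.bigPhi (exch x) i) i i = g.redPhi₁ (N : ℝ)⁻¹ x := by
  have hN : (N : ℝ) ≠ 0 := Nat.cast_ne_zero.2 i.pos.ne'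
  refine (g.bigPhi_submatrix _ i i i).trans ?_
  simp only [bigR_exch, bigS_exch, bigM₀_exch, block_exch]
  rw [bigQ_submatrix, if_pos rfl, exchBlock_self, sum_exchBlock_left, sum_exchBlock_right,
    sum_erase_eq_smul fun k hk => by rw [exchBlock_left x hk, bigU_exch_ne _ _ hk.symm],
    sum_erase_eq_smul fun k hk => by rw [exchBlock_right x hk, bigU_exch_ne _ _ hk.symm],
    sum_erase_eq_smul fun k hk => by rw [exchBlock_diag x hk, bigU_exch_ne _ _ hk.symm],
    redPhi₁, redX, Fintype.card_fin]
  simp only [Matrix.mul_smul, Matrix.smul_mul, smul_smul, transpose_smul, Matrix.mul_assoc]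
  match_scalars <;> field_simp

theorem block_bigPhi_exch_left (hl : l ≠ i) :
    block (g.bigPhi (exch x) i) i l = (N : ℝ)⁻¹ • g.redPhi₂ (N : ℝ)⁻¹ x := by
  have hN : (N : ℝ) ≠ 0 := Nat.cast_ne_zero.2 i.pos.ne'
  refine (g.bigPhi_submatrix _ i i l).trans ?_
  simp only [bigR_exch, bigS_exch, bigM₀_exch, block_exch]
  rw [bigQ_submatrix, if_pos rfl, if_neg hl, exchBlock_self, exchBlock_left x hl,
    sum_exchBlock_left, sum_exchBlock_col x hl,
    sum_erase_eq_add_smul hl fun k hk hkl => by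
      rw [exchBlock_left x hk, bigU_exch_ne _ _ hkl.symm],
    sum_erase_eq_add_smul hl fun k hk hkl => by
      rw [exchBlock_off x hk hl hkl, bigU_exch_ne _ _ hk.symm],
    sum_erase_eq_add_smul hl fun k hk hkl => by
      rw [exchBlock_diag x hk, bigU_exch_ne _ _ hk.symm, bigU_exch_ne _ _ hkl.symm],
    bigU_exch_self, bigU_exch_ne _ _ hl.symm, exchBlock_left x hl, exchBlock_diag x hl, redPhi₂,
    redX, Fintype.card_fin]
  simp only [Matrix.mul_smul, Matrix.smul_mul, smul_smul, transpose_smul, zero_sub, Matrix.mul_neg,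
    Matrix.mul_add, Matrix.mul_assoc]
  match_scalars <;> field_simp

theorem block_bigPhi_exch_diag (hj : j ≠ i) :
    block (g.bigPhi (exch x) i) j j = ((N : ℝ)⁻¹ ^ 2) • g.redPhi₃ (N : ℝ)⁻¹ x := by
  have hN : (N : ℝ) ≠ 0 := Nat.cast_ne_zero.2 i.pos.ne'
  refine (g.bigPhi_submatrix _ i j j).trans ?_
  simp only [bigR_exch, bigS_exch, bigM₀_exch, block_exch]
  rw [bigQ_submatrix, if_neg hj, exchBlock_diag x hj, exchBlock_left x hj, exchBlock_right x hj,
    sum_exchBlock_row x hj, sum_exchBlock_col x hj,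
    sum_erase_eq_add_smul hj fun k hk hkj => by
      rw [exchBlock_off x hj hk hkj.symm, bigU_exch_ne _ _ hkj.symm],
    sum_erase_eq_add_smul hj fun k hk hkj => by
      rw [exchBlock_off x hk hj hkj, bigU_exch_ne _ _ hkj.symm],
    sum_erase_eq_add_smul hj fun k hk hkj => by
      rw [exchBlock_diag x hk, bigU_exch_ne _ _ hkj.symm],
    bigU_exch_self, exchBlock_diag x hj, redPhi₃, redPhiCommon, redX, Fintype.card_fin]
  simp only [Matrix.mul_smul, Matrix.smul_mul, smul_smul, transpose_smul, zero_sub, Matrix.mul_neg,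
    Matrix.neg_mul, transpose_neg, Matrix.mul_assoc]
  match_scalars <;> field_simp

theorem block_bigPhi_exch_off (hj : j ≠ i) (hl : l ≠ i) (hjl : j ≠ l) :
    block (g.bigPhi (exch x) i) j l = ((N : ℝ)⁻¹ ^ 2) • g.redPhi₄ (N : ℝ)⁻¹ x := by
  have hN : (N : ℝ) ≠ 0 := Nat.cast_ne_zero.2 i.pos.ne'
  refine (g.bigPhi_submatrix _ i j l).trans ?_
  simp only [bigR_exch, bigS_exch, bigM₀_exch, block_exch]
  rw [bigQ_submatrix, if_neg hj, if_neg hl, exchBlock_off x hj hl hjl, exchBlock_left x hl,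
    exchBlock_right x hj, sum_exchBlock_row x hj, sum_exchBlock_col x hl,
    sum_erase_eq_add_add_smul hj hl hjl fun k hk hkj hkl => by
      rw [exchBlock_off x hj hk hkj.symm, bigU_exch_ne _ _ hkl.symm],
    sum_erase_eq_add_add_smul hj hl hjl fun k hk hkj hkl => by
      rw [exchBlock_off x hk hl hkl, bigU_exch_ne _ _ hkj.symm],
    sum_erase_eq_add_add_smul hj hl hjl fun k hk hkj hkl => by
      rw [exchBlock_diag x hk, bigU_exch_ne _ _ hkj.symm, bigU_exch_ne _ _ hkl.symm],
    bigU_exch_self, bigU_exch_self, bigU_exch_ne _ _ hjl, bigU_exch_ne _ _ hjl.symm,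
    exchBlock_diag x hj, exchBlock_diag x hl, exchBlock_off x hj hl hjl, redPhi₄, redPhiCommon,
    redX, Fintype.card_fin]
  simp only [Matrix.mul_smul, Matrix.smul_mul, smul_smul, transpose_smul, zero_sub, Matrix.mul_neg,
    Matrix.neg_mul, transpose_neg, Matrix.mul_assoc]
  match_scalars <;> field_simp

theorem quadOf_bigPhi_exch (hj : j ≠ i) (hl : l ≠ i) (hjl : j ≠ l) :
    quadOf i j l (g.bigPhi (exch x) i) = g.redPhi (N : ℝ)⁻¹ x := by
  have hN : (N : ℝ) ≠ 0 := Nat.cast_ne_zero.2 i.pos.ne'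
  simp only [quadOf, block_bigPhi_exch_self, block_bigPhi_exch_left _ _ hj,
    block_bigPhi_exch_diag _ _ hj, block_bigPhi_exch_off _ _ hj hl hjl, inv_pow,
    smul_inv_smul₀ hN, smul_inv_smul₀ (pow_ne_zero 2 hN), redPhi]

theorem quadOf_bigQf (hj : j ≠ i) (hl : l ≠ i) :
    quadOf i j l (g.bigQf N i) = g.redTerminal (N : ℝ)⁻¹ := by
  have hN : (N : ℝ) ≠ 0 := Nat.cast_ne_zero.2 i.pos.ne'
  have hblock : ∀ p q, block (g.bigQf N i) p q = _ := g.bigQf_submatrix i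
  simp only [quadOf, redTerminal, hblock, if_true, if_neg hj, if_neg hl, zero_sub, transpose_neg,
    transpose_smul, Matrix.neg_mul, Matrix.mul_neg, neg_neg, Matrix.smul_mul, Matrix.mul_smul,
    smul_neg, smul_inv_smul₀ hN, pow_two, mul_smul]

end Reduction

section ReducedSystem

open Filter Topology Metric
open scoped Matrix.Norms.Frobenius

/-- The right-hand side of the reduced system, the equation for the rescaled blocks of a solution of
the large Riccati system, with `h = 1 / N`. Taking symmetric parts changes nothing for symmetric
quadruples and ensures that every solution with a symmetric terminal value is symmetric. -/
noncomputable def redField (h : ℝ) (x : Quad n) : Quad n :=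
  (-symPart (g.redPhi₁ h x), -g.redPhi₂ h x, -symPart (g.redPhi₃ h x), -symPart (g.redPhi₄ h x))

theorem isSymm_redField (h : ℝ) (x : Quad n) : (g.redField h x).IsSymm where
  isSymm₁ := (isSymm_symPart _).neg
  isSymm₃ := (isSymm_symPart _).neg
  isSymm₄ := (isSymm_symPart _).neg

variable {g} in
theorem isSymm_redTerminal (hQf : g.Qf.IsSymm) (h : ℝ) : (g.redTerminal h).IsSymm where
  isSymm₁ := by
    simp only [IsSymm, Quad.Λ₁, redTerminal, transpose_mul, transpose_transpose, hQf.eq,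
      Matrix.mul_assoc]
  isSymm₃ := by
    simp only [IsSymm, Quad.Λ₃, redTerminal, transpose_mul, transpose_transpose, hQf.eq,
      Matrix.mul_assoc]
  isSymm₄ := by
    simp only [IsSymm, Quad.Λ₄, redTerminal, transpose_mul, transpose_transpose, hQf.eq,
      Matrix.mul_assoc]

theorem redField_of_isSymm_redPhi {h : ℝ} {x : Quad n} (hx : (g.redPhi h x).IsSymm) :
    g.redField h x = -g.redPhi h x := by
  have h₁ := symPart_of_isSymm hx.isSymm₁
  have h₃ := symPart_of_isSymm hx.isSymm₃
  have h₄ := symPart_of_isSymm hx.isSymm₄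
  simp only [redPhi] at h₁ h₃ h₄
  simp only [redField, redPhi, h₁, h₃, h₄, Prod.neg_mk]

section Exch

variable {g} {x : Quad n} {i j l : Fin N}

theorem redField_eq_neg_quadOf (hQ : g.Q.IsSymm) (hR : g.R.IsSymm) (hx : x.IsSymm) (hji : j ≠ i)
    (hli : l ≠ i) (hjl : j ≠ l) :
    g.redField (N : ℝ)⁻¹ x = -quadOf i j l (g.bigPhi (exch x) i) := by
  have h := ((isExchangeable_exch hx).bigPhi g hQ hR).isSymm_quadOf hji hli
  rw [g.quadOf_bigPhi_exch x hji hli hjl] at h ⊢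
  exact g.redField_of_isSymm_redPhi h

theorem exchBlock_neg (x : Quad n) (i j l : Fin N) : exchBlock (-x) i j l = -exchBlock x i j l := by
  unfold exchBlock
  split_ifs <;> simp only [Quad.Λ₁, Quad.Λ₂, Quad.Λ₃, Quad.Λ₄, Prod.fst_neg, Prod.snd_neg,
    transpose_neg, smul_neg]

theorem exch_neg (x : Quad n) (i : Fin N) : exch (-x) i = -exch x i := by
  ext p q
  simp only [exch, exchBlock_neg, of_apply, Matrix.neg_apply]

theorem exch_redField (hQ : g.Q.IsSymm) (hR : g.R.IsSymm) (hx : x.IsSymm) (hN : 3 ≤ N)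
    (i : Fin N) : exch (g.redField (N : ℝ)⁻¹ x) i = -g.bigPhi (exch x) i := by
  have hji : (⟨1, by omega⟩ : Fin N) ≠ ⟨0, by omega⟩ := by simp
  have hli : (⟨2, by omega⟩ : Fin N) ≠ ⟨0, by omega⟩ := by simp
  have hjl : (⟨1, by omega⟩ : Fin N) ≠ ⟨2, by omega⟩ := by simp
  rw [redField_eq_neg_quadOf hQ hR hx hji hli hjl, exch_neg,
    ((isExchangeable_exch hx).bigPhi g hQ hR).exch_quadOf hji hli hjl]

theorem exch_redTerminal (hQf : g.Qf.IsSymm) (hN : 3 ≤ N) (i : Fin N) :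
    exch (g.redTerminal (N : ℝ)⁻¹) i = g.bigQf N i := by
  have hji : (⟨1, by omega⟩ : Fin N) ≠ ⟨0, by omega⟩ := by simp
  have hli : (⟨2, by omega⟩ : Fin N) ≠ ⟨0, by omega⟩ := by simp
  have hjl : (⟨1, by omega⟩ : Fin N) ≠ ⟨2, by omega⟩ := by simp
  rw [← g.quadOf_bigQf hji hli, (isExchangeable_bigQf g hQf).exch_quadOf hji hli hjl]

end Exch

section Zero

variable (x : Quad n)

theorem redPhi₁_zero : g.redPhi₁ 0 x = -g.Ψ₁ x.Λ₁ := by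
  simp only [redPhi₁, Ψ₁, zero_smul, zero_mul, sub_zero, add_zero, transpose_one, Matrix.one_mul,
    Matrix.mul_one, ne_eq, OfNat.ofNat_ne_zero, not_false_eq_true, zero_pow]
  abel

theorem redPhi₂_zero : g.redPhi₂ 0 x = -g.Ψ₂ x.Λ₁ x.Λ₂ := by
  simp only [redPhi₂, Ψ₂, redU, redW, zero_smul, mul_zero, sub_zero, add_zero, one_smul,
    transpose_one, Matrix.one_mul, ne_eq, OfNat.ofNat_ne_zero, not_false_eq_true, zero_pow,
    Matrix.mul_add, Matrix.add_mul, Matrix.mul_assoc]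
  abel

theorem redField_zero_fst : (g.redField 0 x).Λ₁ = symPart (g.Ψ₁ x.Λ₁) := by
  simp only [redField, redPhi₁_zero, symPart, transpose_neg]
  module

theorem redField_zero_snd : (g.redField 0 x).Λ₂ = g.Ψ₂ x.Λ₁ x.Λ₂ := by
  simp only [redField, redPhi₂_zero, neg_neg]

theorem redTerminal_zero :
    g.redTerminal 0 = (g.Qf, -(g.Qf * g.Γf), g.Γfᵀ * g.Qf * g.Γf, g.Γfᵀ * g.Qf * g.Γf) := by
  simp only [redTerminal, zero_smul, sub_zero, transpose_one, Matrix.one_mul, Matrix.mul_one]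

theorem redI_zero : g.redI 0 x = 1 := by
  simp only [redI, zero_smul, add_zero]

variable {g} in
theorem isSymm_R₁ (hR : g.R.IsSymm) {X : Matrix (Fin n) (Fin n) ℝ} (hX : X.IsSymm) :
    (g.R₁ X).IsSymm := by
  simp only [IsSymm, R₁, transpose_add, transpose_mul, transpose_transpose, hR.eq, hX.eq,
    Matrix.mul_assoc]

variable {g} in
theorem isSymm_Ψ₁ (hQ : g.Q.IsSymm) (hR : g.R.IsSymm) {X : Matrix (Fin n) (Fin n) ℝ}
    (hX : X.IsSymm) : (g.Ψ₁ X).IsSymm := by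
  have hH : ((g.R₁ X)⁻¹)ᵀ = (g.R₁ X)⁻¹ := (isSymm_R₁ hR hX).inv.eq
  simp only [IsSymm, Ψ₁, transpose_sub, transpose_mul, transpose_transpose, hH, hX.eq, hQ.eq,
    Matrix.mul_assoc]
  abel

theorem isLinearMap_redPhi_zero (X Y : Matrix (Fin n) (Fin n) ℝ) :
    IsLinearMap ℝ (fun y => g.redPhi₃ 0 (X, Y, y) - g.redPhi₃ 0 (X, Y, 0)) ∧
      IsLinearMap ℝ (fun y => g.redPhi₄ 0 (X, Y, y) - g.redPhi₄ 0 (X, Y, 0)) := by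
  have hM y : g.redM 0 (X, Y, y) = g.redM 0 (X, Y, 0) := by simp only [redM, redI_zero]
  have hU y : g.redU 0 (X, Y, y) = g.Bᵀ * X := by
    simp only [redU, ne_eq, OfNat.ofNat_ne_zero, not_false_eq_true, zero_pow, zero_smul, add_zero]
  have hW y : g.redW 0 (X, Y, y) = g.Bᵀ * Y := by simp only [redW, zero_smul, add_zero]
  simp only [redPhi₃, redPhi₄, redPhiCommon, redX, redS, hU, hW, Quad.Λ₁, Quad.Λ₂, Quad.Λ₃, Quad.Λ₄]
  simp only [hM]
  generalize g.redM 0 (X, Y, 0) = M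
  generalize (g.R₁ X)⁻¹ = H
  simp only [ne_eq, OfNat.ofNat_ne_zero, not_false_eq_true, zero_pow, zero_smul, mul_zero, sub_zero,
    add_zero, zero_add, one_smul, zero_mul]
  refine ⟨⟨fun y y' => ?_, fun r y => ?_⟩, ⟨fun y y' => ?_, fun r y => ?_⟩⟩ <;>
  · simp only [Prod.fst_add, Prod.snd_add, Prod.smul_fst, Prod.smul_snd, Prod.fst_zero,
      Prod.snd_zero, Matrix.mul_add, Matrix.add_mul, Matrix.mul_smul, Matrix.smul_mul,
      Matrix.mul_zero, Matrix.zero_mul]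
    module

theorem isLinearMap_redField_zero (X Y : Matrix (Fin n) (Fin n) ℝ) :
    IsLinearMap ℝ fun y => (g.redField 0 (X, Y, y)).2.2 - (g.redField 0 (X, Y, 0)).2.2 := by
  obtain ⟨h₃, h₄⟩ := g.isLinearMap_redPhi_zero X Y
  have hf y : (g.redField 0 (X, Y, y)).2.2 - (g.redField 0 (X, Y, 0)).2.2 =
      (-symPart (g.redPhi₃ 0 (X, Y, y) - g.redPhi₃ 0 (X, Y, 0)),
        -symPart (g.redPhi₄ 0 (X, Y, y) - g.redPhi₄ 0 (X, Y, 0))) := by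
    simp only [redField, symPart, transpose_sub, Prod.mk_sub_mk, Prod.mk.injEq]
    constructor <;> module
  simp only [hf]
  constructor
  · intro y y'
    simp only [h₃.map_add, h₄.map_add, symPart, transpose_add, Prod.mk_add_mk, Prod.mk.injEq]
    constructor <;> module
  · intro r y
    simp only [h₃.map_smul, h₄.map_smul, symPart, transpose_smul, Prod.smul_mk, Prod.mk.injEq]
    constructor <;> module

end Zero

section Regularity

theorem continuous_redTerminal : Continuous g.redTerminal := by
  unfold redTerminal
  fun_prop

theorem contDiffAt_R₁ (p : ℝ × Quad n) :
    ContDiffAt ℝ 1 (fun q : ℝ × Quad n => g.R₁ q.2.Λ₁) p := by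
  unfold R₁
  fun_prop

theorem contDiffAt_redS (p : ℝ × Quad n) :
    ContDiffAt ℝ 1 (fun q : ℝ × Quad n => g.redS q.1 q.2) p := by
  unfold redS
  fun_prop

theorem contDiffAt_redI {p : ℝ × Quad n} (hR : IsUnit (g.R₁ p.2.Λ₁)) :
    ContDiffAt ℝ 1 (fun q : ℝ × Quad n => g.redI q.1 q.2) p := by
  have hH := contDiffAt_matrix_inv (g.contDiffAt_R₁ p) hR
  have hS := g.contDiffAt_redS p
  unfold redI
  fun_prop

theorem contDiffAt_redField {p : ℝ × Quad n} (hR : IsUnit (g.R₁ p.2.Λ₁))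
    (hI : IsUnit (g.redI p.1 p.2)) :
    ContDiffAt ℝ 1 (fun q : ℝ × Quad n => g.redField q.1 q.2) p := by
  have hH := contDiffAt_matrix_inv (g.contDiffAt_R₁ p) hR
  have hS := g.contDiffAt_redS p
  have hI' := contDiffAt_matrix_inv (g.contDiffAt_redI hR) hI
  have hM : ContDiffAt ℝ 1 (fun q : ℝ × Quad n => g.redM q.1 q.2) p := by
    unfold redM
    fun_prop
  have hU : ContDiffAt ℝ 1 (fun q : ℝ × Quad n => g.redU q.1 q.2) p := by
    unfold redU
    fun_prop
  have hW : ContDiffAt ℝ 1 (fun q : ℝ × Quad n => g.redW q.1 q.2) p := by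
    unfold redW
    fun_prop
  have hX : ContDiffAt ℝ 1 (fun q : ℝ × Quad n => g.redX q.2) p := by
    unfold redX
    fun_prop
  have hC : ContDiffAt ℝ 1 (fun q : ℝ × Quad n => g.redPhiCommon q.1 q.2) p := by
    unfold redPhiCommon
    fun_prop
  unfold redField redPhi₁ redPhi₂ redPhi₃ redPhi₄ symPart
  fun_prop

end Regularity

end ReducedSystem

section ReducedSolution

open Filter Topology Metric
open scoped Matrix.Norms.Frobenius NNReal

/-- `z` solves the reduced system on `[0, T]`, including its terminal condition, with the parameter
`h = 1 / N`; for `h = 0` this is an extension of the limit system. -/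
structure IsReducedSolution (h : ℝ) (z : ℝ → Quad n) : Prop where
  terminal : z g.T = g.redTerminal h
  deriv : ∀ t ∈ Icc 0 g.T, HasDerivWithinAt z (g.redField h (z t)) (Icc 0 g.T) t

/-- The constraints of the large Riccati system in terms of the parameter `h = 1 / N` and the
rescaled blocks, with a lower bound `c` that is uniform in `h`. Symmetric parts make sense of the
matrix inequalities at quadruples that are not symmetric. -/
structure IsAdmissible (c : ℝ) (p : ℝ × Quad n) : Prop where
  isUnit_R₁ : IsUnit (g.R₁ p.2.Λ₁)
  isUnit_redI : IsUnit (g.redI p.1 p.2)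
  posSemidef : (symPart (g.R₁ p.2.Λ₁) - c • (1 : Matrix (Fin m) (Fin m) ℝ)).PosSemidef
  posSemidef_add :
    (symPart (g.R₁ p.2.Λ₁ + p.1 ^ 2 • g.redS p.1 p.2)
      - c • (1 : Matrix (Fin m) (Fin m) ℝ)).PosSemidef

variable {g}

theorem IsAdmissible.mono {c c' : ℝ} {p : ℝ × Quad n} (hp : g.IsAdmissible c p) (hc : c' ≤ c) :
    g.IsAdmissible c' p where
  isUnit_R₁ := hp.isUnit_R₁
  isUnit_redI := hp.isUnit_redI
  posSemidef := posSemidef_sub_smul_one_of_le hp.posSemidef hc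
  posSemidef_add := posSemidef_sub_smul_one_of_le hp.posSemidef_add hc

theorem IsAdmissible.posSemidef_R₁_sub {c : ℝ} {p : ℝ × Quad n} (hp : g.IsAdmissible c p)
    (hR : g.R.IsSymm) (hp₁ : p.2.Λ₁.IsSymm) :
    (g.R₁ p.2.Λ₁ - c • (1 : Matrix (Fin m) (Fin m) ℝ)).PosSemidef := by
  rw [← symPart_of_isSymm (isSymm_R₁ hR hp₁)]
  exact hp.posSemidef

theorem eventually_isAdmissible {x : Quad n} (hx : (g.R₁ x.Λ₁).PosDef) :
    ∃ c > 0, ∀ᶠ p in 𝓝 ((0 : ℝ), x), g.IsAdmissible c p := by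
  have hR := (g.contDiffAt_R₁ (0, x)).continuousAt
  have hI := (g.contDiffAt_redI (p := (0, x)) hx.isUnit).continuousAt
  have hI₀ : IsUnit (g.redI 0 x) := by simp only [redI_zero, isUnit_one]
  have hRS : ContinuousAt (fun p : ℝ × Quad n => g.R₁ p.2.Λ₁ + p.1 ^ 2 • g.redS p.1 p.2) (0, x) :=
    hR.add ((continuousAt_fst.pow 2).smul (g.contDiffAt_redS (0, x)).continuousAt)
  have hRS₀ : g.R₁ x.Λ₁ + (0 : ℝ) ^ 2 • g.redS 0 x = g.R₁ x.Λ₁ := by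
    rw [zero_pow two_ne_zero, zero_smul, add_zero]
  obtain ⟨c, hc, h⟩ := eventually_posSemidef_symPart_sub_smul_one hx
  refine ⟨c, hc, ?_⟩
  filter_upwards [hR.eventually (Units.nhds hx.isUnit.unit),
    hI.eventually (Units.nhds hI₀.unit), hR.eventually h,
    hRS.eventually (hRS₀.symm ▸ h)] with p h₁ h₂ h₃ h₄ using ⟨h₁, h₂, h₃, h₄⟩

theorem exists_lipschitzOnWith_and_isAdmissible {s : Set (Quad n)} (hs : IsCompact s)
    (hpos : ∀ x ∈ s, (g.R₁ x.Λ₁).PosDef) :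
    ∃ r > 0, r < 1 ∧ ∃ K, ∀ x ∈ s,
      LipschitzOnWith K (fun p : ℝ × Quad n => g.redField p.1 p.2) (ball (0, x) r) ∧
        ∀ p ∈ ball ((0 : ℝ), x) r, g.IsAdmissible r p := by
  have hev := eventually_forall_ball_of_isCompact (s := {(0 : ℝ)} ×ˢ s)
    (isCompact_singleton.prod hs) (Q := fun r U =>
      LipschitzOnWith (r⁻¹).toNNReal (fun p : ℝ × Quad n => g.redField p.1 p.2) U ∧
        ∀ p ∈ U, g.IsAdmissible r p)
    (fun r U V hUV h => ⟨h.1.mono hUV, fun p hp => h.2 p (hUV hp)⟩) ?_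
  · obtain ⟨r, h, hr1, hr⟩ :=
      (hev.and ((eventually_nhdsWithin_of_eventually_nhds (eventually_lt_nhds one_pos)).and
        self_mem_nhdsWithin)).exists
    exact ⟨r, hr, hr1, _, fun x hx => h (0, x) ⟨rfl, hx⟩⟩
  · rintro ⟨_, x⟩ ⟨rfl, hx⟩
    obtain ⟨c, hc, hadm⟩ := eventually_isAdmissible (hpos x hx)
    obtain ⟨K, U, hU, hK⟩ := (g.contDiffAt_redField (p := (0, x)) (hpos x hx).isUnit
      (by simp only [redI_zero, isUnit_one])).exists_lipschitzOnWith
    refine ⟨_, inter_mem hU hadm, ?_⟩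
    filter_upwards [tendsto_inv_nhdsGT_zero.eventually_ge_atTop (K : ℝ),
      eventually_nhdsWithin_of_eventually_nhds (eventually_le_nhds hc)] with r hrK hrc
    exact ⟨(hK.mono inter_subset_left).weaken (NNReal.le_toNNReal_of_coe_le hrK),
      fun p hp => hp.2.mono hrc⟩

theorem eventually_exists_isReducedSolution_near (hT : 0 ≤ g.T) {s : Set (Quad n)}
    (hs : IsCompact s) (hpos : ∀ x ∈ s, (g.R₁ x.Λ₁).PosDef) :
    ∃ c > 0, ∀ᶠ p in 𝓝 ((0 : ℝ), (0 : ℝ)), ∀ z, g.IsReducedSolution p.1 z →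
      MapsTo z (Icc 0 g.T) s → ∃ y, g.IsReducedSolution p.2 y ∧
        ∀ t ∈ Icc 0 g.T, dist (y t) (z t) < 1 ∧ g.IsAdmissible c (p.2, y t) := by
  obtain ⟨r, hr, hr1, K, h⟩ := exists_lipschitzOnWith_and_isAdmissible hs hpos
  refine ⟨r, hr, ?_⟩
  have hball : ∀ᶠ p in 𝓝 ((0 : ℝ), (0 : ℝ)), p.2 ∈ ball 0 r :=
    continuousAt_snd.eventually (ball_mem_nhds _ hr)
  filter_upwards [hball, eventually_exists_terminal_solution_near (θ₀ := 0)
    (F := fun p : ℝ × Quad n => g.redField p.1 p.2) hT g.continuous_redTerminal.continuousAt hr K]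
    with p hp hnear z hz hzs
  obtain ⟨y, hyT, hy, hyz⟩ := hnear z hz.terminal hz.deriv fun t ht => (h (z t) (hzs ht)).1
  refine ⟨y, ⟨hyT, hy⟩, fun t ht => ⟨(hyz t ht).trans hr1, (h (z t) (hzs ht)).2 _ ?_⟩⟩
  rw [← ball_prod_same]
  exact ⟨hp, hyz t ht⟩

theorem IsReducedSolution.isSymm {h : ℝ} {z : ℝ → Quad n} (hz : g.IsReducedSolution h z)
    (hQf : g.Qf.IsSymm) {t : ℝ} (ht : t ∈ Icc 0 g.T) : (z t).IsSymm := by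
  have hT : g.T ∈ Icc 0 g.T := right_mem_Icc.2 (ht.1.trans ht.2)
  have hzT : (z g.T).IsSymm := hz.terminal ▸ isSymm_redTerminal hQf h
  have hz' u : (g.redField h (z u)).IsSymm := g.isSymm_redField h (z u)
  exact
    { isSymm₁ := isSymm_of_hasDerivWithinAt (convex_Icc 0 g.T)
        (fun u hu => (hz.deriv u hu).fst) (fun u _ => (hz' u).isSymm₁) hT hzT.isSymm₁ ht
      isSymm₃ := isSymm_of_hasDerivWithinAt (convex_Icc 0 g.T)
        (fun u hu => (hz.deriv u hu).snd.snd.fst) (fun u _ => (hz' u).isSymm₃) hT hzT.isSymm₃ ht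
      isSymm₄ := isSymm_of_hasDerivWithinAt (convex_Icc 0 g.T)
        (fun u hu => (hz.deriv u hu).snd.snd.snd) (fun u _ => (hz' u).isSymm₄) hT hzT.isSymm₄ ht }

end ReducedSolution

section Limit

open scoped Matrix.Norms.Frobenius

variable {g}

theorem IsReducedSolution.isLimitSolution {c : ℝ} {z : ℝ → Quad n} (hz : g.IsReducedSolution 0 z)
    (hQ : g.Q.IsSymm) (hQf : g.Qf.IsSymm) (hR : g.R.IsSymm) (hc : 0 < c)
    (hadm : ∀ t ∈ Icc 0 g.T, g.IsAdmissible c (0, z t)) :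
    g.IsLimitSolution (fun t => (z t).Λ₁) fun t => (z t).Λ₂ := by
  have hsymm t (ht : t ∈ Icc 0 g.T) := (hz.isSymm hQf ht).isSymm₁
  have hT := hz.terminal
  rw [redTerminal_zero] at hT
  refine ⟨hsymm, fun t ht => ?_, congrArg Quad.Λ₁ hT, fun t ht => ?_, fun t ht => ?_,
    congrArg Quad.Λ₂ hT⟩
  · rw [← symPart_of_isSymm (isSymm_Ψ₁ hQ hR (hsymm t ht)), ← redField_zero_fst]
    exact (hz.deriv t ht).fst
  · exact posDef_of_posSemidef_sub_smul_one hc ((hadm t ht).posSemidef_R₁_sub hR (hsymm t ht))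
  · rw [← redField_zero_snd]
    exact (hz.deriv t ht).snd.fst

theorem IsLimitSolution.continuousOn_redField_zero {L₁ L₂ : ℝ → Matrix (Fin n) (Fin n) ℝ}
    (h : g.IsLimitSolution L₁ L₂) (y : Matrix (Fin n) (Fin n) ℝ × Matrix (Fin n) (Fin n) ℝ) :
    ContinuousOn (fun t => g.redField 0 (L₁ t, L₂ t, y)) (Icc 0 g.T) := fun t ht =>
  have hF := (g.contDiffAt_redField (p := (0, (L₁ t, L₂ t, y))) (h.posDef t ht).isUnit
    (by simp only [redI_zero, isUnit_one])).continuousAt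
  hF.comp_continuousWithinAt (f := fun t => ((0 : ℝ), ((L₁ t, L₂ t, y) : Quad n))) <|
    continuousWithinAt_const.prodMk <| (h.deriv₁ t ht).continuousWithinAt.prodMk <|
      (h.deriv₂ t ht).continuousWithinAt.prodMk continuousWithinAt_const

theorem IsLimitSolution.exists_isReducedSolution {L₁ L₂ : ℝ → Matrix (Fin n) (Fin n) ℝ}
    (h : g.IsLimitSolution L₁ L₂) (hT : 0 ≤ g.T) (hQ : g.Q.IsSymm) (hR : g.R.IsSymm) :
    ∃ y : ℝ → Matrix (Fin n) (Fin n) ℝ × Matrix (Fin n) (Fin n) ℝ,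
      g.IsReducedSolution 0 fun t => (L₁ t, L₂ t, y t) := by
  let A (t : ℝ) := ((g.isLinearMap_redField_zero (L₁ t) (L₂ t)).mk' _).toContinuousLinearMap
  have hAy t y : A t y + (g.redField 0 (L₁ t, L₂ t, 0)).2.2 = (g.redField 0 (L₁ t, L₂ t, y)).2.2 :=
    sub_add_cancel _ _
  have hcont y : ContinuousOn (fun t => (g.redField 0 (L₁ t, L₂ t, y)).2.2) (Icc 0 g.T) :=
    (h.continuousOn_redField_zero y).snd.snd
  have hA : ContinuousOn A (Icc 0 g.T) :=
    continuousOn_clm_apply.2 fun y => (hcont y).sub (hcont 0)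
  obtain ⟨y, hyT, hy⟩ := exists_terminal_solution_of_linear hT hA (hcont 0) (g.redTerminal 0).2.2
  refine ⟨y, ?_, fun t ht => ?_⟩
  · simp only [h.terminal₁, h.terminal₂, hyT, redTerminal_zero]
  · have h₁ : (g.redField 0 (L₁ t, L₂ t, y t)).Λ₁ = g.Ψ₁ (L₁ t) := by
      rw [redField_zero_fst, symPart_of_isSymm (isSymm_Ψ₁ hQ hR (h.symm t ht))]
    have hfield : g.redField 0 (L₁ t, L₂ t, y t) = (g.Ψ₁ (L₁ t), g.Ψ₂ (L₁ t) (L₂ t),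
        A t (y t) + (g.redField 0 (L₁ t, L₂ t, 0)).2.2) :=
      Prod.ext h₁ (Prod.ext (g.redField_zero_snd _) (hAy t (y t)).symm)
    rw [hfield]
    exact (h.deriv₁ t ht).prodMk ((h.deriv₂ t ht).prodMk (hy t ht))

end Limit

section Correspondence

open scoped Matrix.Norms.Frobenius

variable {g}

theorem hasDerivWithinAt_exch {y : ℝ → Quad n} {y' : Quad n} {s : Set ℝ} {t : ℝ}
    (hy : HasDerivWithinAt y y' s t) (i : Fin N) :
    HasDerivWithinAt (fun u => exch (y u) i) (exch y' i) s t := by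
  refine hasDerivWithinAt_matrix.2 fun p q => ?_
  have h₁ := hasDerivWithinAt_matrix.1 hy.fst
  have h₂ := hasDerivWithinAt_matrix.1 hy.snd.fst
  have h₃ := hasDerivWithinAt_matrix.1 hy.snd.snd.fst
  have h₄ := hasDerivWithinAt_matrix.1 hy.snd.snd.snd
  simp only [exch, exchBlock, of_apply]
  split_ifs
  exacts [h₁ _ _, (h₂ _ _).const_mul _, (h₂ _ _).const_mul _, (h₃ _ _).const_mul _,
    (h₄ _ _).const_mul _]

theorem hasDerivWithinAt_quadOf {X : ℝ → Matrix (Fin N × Fin n) (Fin N × Fin n) ℝ}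
    {X' : Matrix (Fin N × Fin n) (Fin N × Fin n) ℝ} {s : Set ℝ} {t : ℝ}
    (hX : HasDerivWithinAt X X' s t) (i j l : Fin N) :
    HasDerivWithinAt (fun u => quadOf i j l (X u)) (quadOf i j l X') s t := by
  have hblock p q : HasDerivWithinAt (fun u => block (X u) p q) (block X' p q) s t :=
    hasDerivWithinAt_matrix.2 fun a b => hasDerivWithinAt_matrix.1 hX (p, a) (q, b)
  exact (hblock i i).prodMk <| ((hblock i j).const_smul (N : ℝ)).prodMk <|
    ((hblock j j).const_smul ((N : ℝ) ^ 2)).prodMk ((hblock j l).const_smul ((N : ℝ) ^ 2))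

theorem quadOf_neg (i j l : Fin N) (X : Matrix (Fin N × Fin n) (Fin N × Fin n) ℝ) :
    quadOf i j l (-X) = -quadOf i j l X := by
  have hblock p q : block (-X) p q = -block X p q := rfl
  simp only [quadOf, hblock, smul_neg, Prod.neg_mk]

theorem IsRiccatiSolution.isReducedSolution {i j l : Fin N}
    {P : Fin N → ℝ → Matrix (Fin N × Fin n) (Fin N × Fin n) ℝ} (hP : g.IsRiccatiSolution N P)
    (hQ : g.Q.IsSymm) (hR : g.R.IsSymm) (hji : j ≠ i) (hli : l ≠ i) (hjl : j ≠ l) :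
    g.IsReducedSolution (N : ℝ)⁻¹ fun t => quadOf i j l (P i t) where
  terminal := by rw [hP.terminal, g.quadOf_bigQf hji hli]
  deriv t ht := by
    have hexch := hP.isExchangeable ht
    rw [redField_eq_neg_quadOf hQ hR (hexch.isSymm_quadOf hji hli) hji hli hjl,
      hexch.exch_quadOf hji hli hjl, ← quadOf_neg]
    exact hasDerivWithinAt_quadOf (hP.deriv i t ht) i j l

theorem IsReducedSolution.isRiccatiSolution {c : ℝ} {y : ℝ → Quad n}
    (hy : g.IsReducedSolution (N : ℝ)⁻¹ y) (hQ : g.Q.IsSymm) (hQf : g.Qf.IsSymm) (hR : g.R.IsSymm)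
    (hN : 3 ≤ N) (hc : 0 < c) (hadm : ∀ t ∈ Icc 0 g.T, g.IsAdmissible c ((N : ℝ)⁻¹, y t)) :
    g.IsRiccatiSolution N fun i t => exch (y t) i := by
  have hexch t (ht : t ∈ Icc 0 g.T) : IsExchangeable (exch (y t) : Fin N → _) :=
    isExchangeable_exch (hy.isSymm hQf ht)
  refine ⟨fun i t ht => (hexch t ht).isSymm i, fun i t ht => ?_, fun i => ?_, fun i t ht => ?_,
    fun i t ht => ?_, fun t ht => ?_⟩
  · rw [← exch_redField hQ hR (hy.isSymm hQf ht) hN i]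
    exact hasDerivWithinAt_exch (hy.deriv t ht) i
  · rw [hy.terminal, exch_redTerminal hQf hN]
  · rw [bigR_exch]
    exact posDef_of_posSemidef_sub_smul_one hc
      ((hadm t ht).posSemidef_R₁_sub hR (hy.isSymm hQf ht).isSymm₁)
  · have hsymm := (g.isSymm_bigR hR ((hexch t ht).isSymm i)).add
      (g.isSymm_bigS ((hexch t ht).isSymm i))
    rw [← symPart_of_isSymm hsymm, bigR_exch, bigS_exch]
    exact posDef_of_posSemidef_sub_smul_one hc (hadm t ht).posSemidef_add
  · rw [bigI_exch _ _ (by omega)]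
    exact (hadm t ht).isUnit_redI

end Correspondence

section RescaledSize

open scoped Matrix.Norms.Frobenius

theorem rescaledSize_eq (hN : 3 ≤ N) (X : Matrix (Fin N × Fin n) (Fin N × Fin n) ℝ) :
    rescaledSize hN X =
      let x := quadOf ⟨0, by omega⟩ ⟨1, by omega⟩ ⟨2, by omega⟩ X
      ‖x.Λ₁‖ + ‖x.Λ₂‖ + ‖x.Λ₃‖ + ‖x.Λ₄‖ := by
  simp only [quadOf, Quad.Λ₁, Quad.Λ₂, Quad.Λ₃, Quad.Λ₄, norm_smul, norm_pow, Real.norm_natCast]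
  rfl

theorem norm_quadOf_le_rescaledSize (hN : 3 ≤ N)
    (X : Matrix (Fin N × Fin n) (Fin N × Fin n) ℝ) :
    ‖quadOf ⟨0, by omega⟩ ⟨1, by omega⟩ ⟨2, by omega⟩ X‖ ≤ rescaledSize hN X := by
  rw [rescaledSize_eq]
  generalize quadOf _ _ _ X = x
  have h₁ := norm_nonneg x.Λ₁
  have h₂ := norm_nonneg x.Λ₂
  have h₃ := norm_nonneg x.Λ₃
  have h₄ := norm_nonneg x.Λ₄
  refine max_le ?_ (max_le ?_ (max_le ?_ ?_)) <;> linarith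

theorem rescaledSize_exch_le (hN : 3 ≤ N) (x : Quad n) :
    rescaledSize hN (exch x ⟨0, by omega⟩) ≤ 4 * ‖x‖ := by
  rw [rescaledSize_eq, quadOf_exch x (by simp) (by simp) (by simp)]
  have h₁ : ‖x.Λ₁‖ ≤ ‖x‖ := norm_fst_le x
  have h₂ : ‖x.Λ₂‖ ≤ ‖x‖ := (norm_fst_le x.2).trans (norm_snd_le x)
  have h₃ : ‖x.Λ₃‖ ≤ ‖x‖ := (norm_fst_le x.2.2).trans ((norm_snd_le x.2).trans (norm_snd_le x))
  have h₄ : ‖x.Λ₄‖ ≤ ‖x‖ := (norm_snd_le x.2.2).trans ((norm_snd_le x.2).trans (norm_snd_le x))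
  linarith

end RescaledSize

section Main

open Filter Topology Metric
open scoped Matrix.Norms.Frobenius

variable {g}

theorem isCompact_setOf_norm_le_and_posSemidef_R₁_sub (c C : ℝ) :
    IsCompact {x : Quad n |
      ‖x‖ ≤ C ∧ (g.R₁ x.Λ₁ - c • (1 : Matrix (Fin m) (Fin m) ℝ)).PosSemidef} := by
  have : ProperSpace (Quad n) := FiniteDimensional.proper ℝ _
  have hball : {x : Quad n | ‖x‖ ≤ C} = closedBall 0 C := by
    ext x
    rw [mem_closedBall_zero_iff, mem_ofPred_eq]
  have hR₁ : Continuous fun x : Quad n => g.R₁ x.Λ₁ - c • (1 : Matrix (Fin m) (Fin m) ℝ) := by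
    unfold R₁
    fun_prop
  rw [ofPred_and, hball]
  exact (isCompact_closedBall _ _).inter_right (isClosed_setOf_posSemidef.preimage hR₁)

theorem AsymptoticallySolvable.exists_isLimitSolution (h : g.AsymptoticallySolvable)
    (hT : 0 ≤ g.T) (hQ : g.Q.IsSymm) (hQf : g.Qf.IsSymm) (hR : g.R.IsSymm) :
    ∃ L₁ L₂ : ℝ → Matrix (Fin n) (Fin n) ℝ, g.IsLimitSolution L₁ L₂ := by
  obtain ⟨N₀, hN₀, c₀, hc₀, C, h⟩ := h
  obtain ⟨c, hc, hnear⟩ := eventually_exists_isReducedSolution_near hT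
    (isCompact_setOf_norm_le_and_posSemidef_R₁_sub (g := g) c₀ C)
    fun x hx => posDef_of_posSemidef_sub_smul_one hc₀ hx.2
  have hinv : Tendsto (fun N : ℕ => ((N : ℝ)⁻¹, (0 : ℝ))) atTop (𝓝 (0, 0)) :=
    tendsto_inv_atTop_nhds_zero_nat.prodMk_nhds tendsto_const_nhds
  obtain ⟨N, hpersist, hN⟩ := ((hinv.eventually hnear).and (eventually_ge_atTop N₀)).exists
  obtain ⟨P, hP, hPC, hPR, -⟩ := h N hN
  have hN3 : 3 ≤ N := hN₀.trans hN
  let i : Fin N := ⟨0, by omega⟩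
  let j : Fin N := ⟨1, by omega⟩
  let l : Fin N := ⟨2, by omega⟩
  have hji : j ≠ i := by simp [i, j]
  have hli : l ≠ i := by simp [i, l]
  have hjl : j ≠ l := by simp [j, l]
  obtain ⟨y, hy, hyadm⟩ := hpersist _ (hP.isReducedSolution hQ hR hji hli hjl) fun t ht => by
    refine ⟨(norm_quadOf_le_rescaledSize hN3 _).trans (hPC t ht), ?_⟩
    rw [← bigR_exch g _ i, (hP.isExchangeable ht).exch_quadOf hji hli hjl]
    exact hPR i t ht
  exact ⟨_, _, hy.isLimitSolution hQ hQf hR hc fun t ht => (hyadm t ht).2⟩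

theorem IsLimitSolution.asymptoticallySolvable {L₁ L₂ : ℝ → Matrix (Fin n) (Fin n) ℝ}
    (h : g.IsLimitSolution L₁ L₂) (hT : 0 ≤ g.T) (hQ : g.Q.IsSymm) (hQf : g.Qf.IsSymm)
    (hR : g.R.IsSymm) : g.AsymptoticallySolvable := by
  obtain ⟨y, hz⟩ := h.exists_isReducedSolution hT hQ hR
  let z (t : ℝ) : Quad n := (L₁ t, L₂ t, y t)
  have hzcompact : IsCompact (z '' Icc 0 g.T) :=
    isCompact_Icc.image_of_continuousOn fun t ht => (hz.deriv t ht).continuousWithinAt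
  obtain ⟨C, hC⟩ := hzcompact.exists_bound_of_continuousOn continuousOn_id
  obtain ⟨c, hc, hnear⟩ := eventually_exists_isReducedSolution_near hT hzcompact <|
    forall_mem_image.2 h.posDef
  have hinv : Tendsto (fun N : ℕ => ((0 : ℝ), (N : ℝ)⁻¹)) atTop (𝓝 (0, 0)) :=
    tendsto_const_nhds.prodMk_nhds tendsto_inv_atTop_nhds_zero_nat
  obtain ⟨N₁, hpersist⟩ := eventually_atTop.1 (hinv.eventually hnear)
  refine ⟨max 3 N₁, le_max_left _ _, c, hc, 4 * (C + 1), fun N hN => ?_⟩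
  have hN3 : 3 ≤ N := (le_max_left _ _).trans hN
  obtain ⟨x, hx, hxz⟩ :=
    hpersist N ((le_max_right _ _).trans hN) z hz (mapsTo_image z _)
  have hP := hx.isRiccatiSolution hQ hQf hR hN3 hc fun t ht => (hxz t ht).2
  refine ⟨_, hP, fun t ht => (rescaledSize_exch_le hN3 (x t)).trans ?_, fun i t ht => ?_,
    hP.isUnit⟩
  · have hdist := norm_le_norm_add_norm_sub' (x t) (z t)
    have hzC : ‖z t‖ ≤ C := hC (z t) (mem_image_of_mem z ht)
    rw [← dist_eq_norm] at hdist
    linarith [(hxz t ht).1]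
  · rw [bigR_exch]
    exact (hxz t ht).2.posSemidef_R₁_sub hR (hx.isSymm hQf ht).isSymm₁

end Main

end LQGame

/-- The LQ Nash game with controlled individual and common noise and symmetric, possibly indefinite,
weights is asymptotically solvable if and only if the low-dimensional Riccati system has a solution
`(Λ₁, Λ₂)` on `[0, T]`. -/
theorem mainTheorem1 {n m : ℕ} (g : LQGame n m) (hT : 0 < g.T)
    (hQ : g.Q.IsSymm) (hQf : g.Qf.IsSymm) (hR : g.R.IsSymm) :
    g.AsymptoticallySolvable ↔
      ∃ L₁ L₂ : ℝ → Matrix (Fin n) (Fin n) ℝ, g.IsLimitSolution L₁ L₂ :=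
  ⟨fun h => h.exists_isLimitSolution hT.le hQ hQf hR,
    fun ⟨_, _, h⟩ => h.asymptoticallySolvable hT.le hQ hQf hR⟩
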